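/- Let $p<q$ be primes and let $a,b\ge 1$ be integers. Let $K\subset S^3$ be either - a $(p^a,q^b)$-torus knot, i.e. the image under a homeomorphism of $S^3$ of the curve $T_{p^a,q^b}=\{\tfrac1{\sqrt2}(z^{p^a},z^{q^b}) : z\in\mathbb C,\ |z|=1\}\subset S^3\subset\mathbb C^2$; or - a $(p^a,q^b)$-cable of some (tame, possibly trivial) knot $C\subset S^3$, i.e. the simple closed curve on the boundary torus of a tubular neighbourhood of $C$ that winds $p^a$ times along the preferred (null-homologous in $S^3\setminus C$) longitude and $q^b$ times along the meridian of $C$ (either handedness, i.e. either sign of $q^b$, is allowed). Let $G=G(K)=\pi_1(S^3\setminus K)$ (with any base point) be the knot group. Then there is a generalized torsion element $g\in G$ with $g\notin[[G,G],[G,G]]$ and $\mathrm{gord}(g)=p$. Here an element $g\neq 1$ of a group $G$ is a generalized torsion element if there are $n\ge 1$ and $x_1,\dots,x_n\in G$ with $(x_1gx_1^{-1})(x_2gx_2^{-1})\cdots(x_ngx_n^{-1})=1$, and its generalized torsion order $\mathrm{gord}(g)$ is the least such $n$. -/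

import Mathlib

/-! ### Generalized torsion -/

/-- The generalized torsion equation spectrum `t(g)`: all positive `n` such that some product of
`n` conjugates of `g` is trivial. -/
def genTorsionSpectrum {G : Type*} [Group G] (g : G) : Set ℕ :=
  {n | 0 < n ∧ ∃ x : Fin n → G, (List.ofFn fun i => x i * g * (x i)⁻¹).prod = 1}

/-- `g` is a generalized torsion element if it is nontrivial and some nonempty product of its
conjugates is trivial. -/
def IsGenTorsion {G : Type*} [Group G] (g : G) : Prop :=
  g ≠ 1 ∧ (genTorsionSpectrum g).Nonempty

/-- The generalized torsion order `gord(g) = min t(g)`, equal to `∞` if `t(g)` is empty. -/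
noncomputable def gord {G : Type*} [Group G] (g : G) : ℕ∞ :=
  ⨅ n ∈ genTorsionSpectrum g, (n : ℕ∞)

/-! ### Loops and homology -/

/-- The loop `t ↦ f (exp (2 π i t))` given by a continuous map from the circle. -/
noncomputable def circleLoop {X : Type*} [TopologicalSpace X] (f : C(Circle, X)) :
    Path (f 1) (f 1) where
  toFun t := f (Circle.exp (2 * Real.pi * (t : ℝ)))
  continuous_toFun := by fun_prop
  source' := by simp
  target' := by simp

/-- A closed curve is null-homologous if its class vanishes in the first homology group of its
path component, the abelianization of the fundamental group. -/
def IsNullHomologous {X : Type*} [TopologicalSpace X] (f : C(Circle, X)) : Prop :=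
  FundamentalGroup.fromPath (Path.Homotopic.Quotient.mk (circleLoop f)) ∈
    commutator (FundamentalGroup X (f 1))

/-! ### Knots in the three-sphere -/

/-- The three-sphere, as the unit sphere of `ℂ²`. -/
abbrev ThreeSphere : Type :=
  Metric.sphere (0 : EuclideanSpace ℂ (Fin 2)) 1

/-- An (open) tubular neighbourhood of `C ⊆ S³`, together with a trivialization: an open embedding
of `S¹ × ℂ` in `S³` that maps `S¹ × {0}` onto `C`. -/
structure TubularNeighborhood (C : Set ThreeSphere) where
  toFun : Circle × ℂ → ThreeSphere
  isOpenEmbedding : Topology.IsOpenEmbedding toFun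
  core_eq : (Set.range fun z : Circle => toFun (z, 0)) = C

/-- A (tame) knot: a circle in `S³` that has a tubular neighbourhood. -/
def IsKnot (C : Set ThreeSphere) : Prop :=
  Nonempty (TubularNeighborhood C)

/-- The knot group `π₁(S³ ∖ K, x)`. -/
abbrev KnotGroup (K : Set ThreeSphere) (x : (Kᶜ : Set ThreeSphere)) : Type :=
  FundamentalGroup (Kᶜ : Set ThreeSphere) x

namespace TubularNeighborhood

variable {C : Set ThreeSphere} (T : TubularNeighborhood C)

theorem apply_notMem (z : Circle) {w : ℂ} (hw : w ≠ 0) : T.toFun (z, w) ∈ Cᶜ := by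
  intro h
  obtain ⟨z', hz'⟩ := T.core_eq.symm.subset h
  exact hw (congrArg Prod.snd (T.isOpenEmbedding.injective hz')).symm

/-- The longitude `S¹ × {1}` of the tubular neighbourhood, as a curve in the complement of `C`. -/
def longitude : C(Circle, (Cᶜ : Set ThreeSphere)) where
  toFun z := ⟨T.toFun (z, 1), T.apply_notMem z one_ne_zero⟩
  continuous_toFun :=
    (T.isOpenEmbedding.continuous.comp (by fun_prop : Continuous fun z : Circle => (z, (1 : ℂ))))
      |>.subtype_mk _

/-- The trivialization is the preferred one (framing zero) if its longitude is null-homologous in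
the complement of the knot. -/
def IsPreferred : Prop :=
  IsNullHomologous T.longitude

/-- The curve `{(z ^ m, z ^ n)}` on the torus `S¹ × {|w| = 1}` around the knot. It winds `m` times
along the longitude and `n` times along the meridian. -/
def cable (m n : ℕ) : Set ThreeSphere :=
  Set.range fun z : Circle => T.toFun (z ^ m, (z : ℂ) ^ n)

end TubularNeighborhood

/-- `K` is an `(m, n)`-cable of the knot `C`, up to orientation: it is the curve
`m · longitude + n · meridian` on the boundary of a tubular neighbourhood of `C`, where the
longitude is the preferred one. The orientation of the tubular neighbourhood is not prescribed,
so that `n` is determined up to sign. -/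
def IsCableOf (m n : ℕ) (C K : Set ThreeSphere) : Prop :=
  ∃ T : TubularNeighborhood C, T.IsPreferred ∧ K = T.cable m n

/-- The standard torus knot `T_{m,n}`, the curve `(z ^ m, z ^ n) / √2` on the Clifford torus. -/
def standardTorusKnot (m n : ℕ) : Set ThreeSphere :=
  {x | ∃ z : Circle, x.1 0 = (z : ℂ) ^ m / (Real.sqrt 2 : ℂ) ∧
    x.1 1 = (z : ℂ) ^ n / (Real.sqrt 2 : ℂ)}

/-- `K` is an `(m, n)`-torus knot: some homeomorphism of `S³` carries `T_{m,n}` to `K`. -/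
def IsTorusKnot (m n : ℕ) (K : Set ThreeSphere) : Prop :=
  ∃ h : ThreeSphere ≃ₜ ThreeSphere, K = h '' standardTorusKnot m n

/-! Write P = p^a, Q = q^b, k = p^(a-1). A torus knot is a cable of the unknot, so K is the curve
z^Q = w^P in a solid torus S¹ × ℂ around C with preferred framing. Let x be the core and y a
meridian of the larger torus |w| = 2, joined to the core by an arc. Sliding along the arc turns x^P
into a curve on that torus, so x^P commutes with y. Put g = ⁅x^k, y⁆. Since (x^k)^p = x^P, the
trivial element ⁅x^P, y⁆ telescopes into a product of p conjugates of g, and gord(g) ≤ p.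

The lower bound and g ∉ G'' come from a crossed homomorphism on G (`exists_degreeCocycle`). The
coordinates (z, w), given near K, extend to a map (u, v) from the complement of K to {u^Q ≠ v^P} in
ℂ² (`exists_complement_map`). The extension of w off the solid torus is a nonvanishing function on
S³ ∖ C; it exists because H²(S³; ℤ) = 0, in the multiplicative form `splitsOn_threeSphere`, and
because the framing is preferred. A logarithm of F = u^Q - v^P rescales (u, v) to a point of the
Milnor fibre a^Q - b^P = 1. There `stripFunction` detects crossings of one of the PQ lifts of a
strip. The monodromy of the two logarithms is a degree d : G → ℤ and a crossed homomorphism w from G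
to functions on ℤ, with d(x) = Q, w(x) = 0, d(y) = P, w(y)(n) = b(n) - b(n + P), where b is
supported on PQℤ and constant there.

So w(g) is the second difference of b with steps P and Qk, and it is nonzero at 0. On G' the map w
is a homomorphism to an abelian group, so it kills G'', whence g ∉ G''. If a product of n conjugates
of g is trivial, then n translates of w(g) sum to zero. Let N(m) count the corresponding translates
of PQℤ that contain m. The difference N(m) - N(m - Qk) is then P-periodic. If it vanishes
identically, N is positive on p classes modulo PQ; otherwise N is positive on Q > p classes. Each
translate accounts for one class, so n ≥ p. -/

/-! ### Counting translates of a sublattice of ℤ -/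

section Counting

/-- If a nonempty sum of translates of the second difference, by `P` and `Q * k`, of the indicator
function of the multiples of `P * Q` vanishes, then it has at least `p` terms. -/
theorem le_of_sum_second_difference_eq_zero {p k Q : ℕ} (hpQ : p ≤ Q) (hk : 0 < k) (hp : 0 < p)
    {n : ℕ} (hn : 0 < n) (D : Fin n → ℤ) (c : ℤ → ℕ)
    (hc : ∀ m, c m = if ((p * k * Q : ℕ) : ℤ) ∣ m then 1 else 0)
    (h : ∀ m : ℤ, ∑ i, ((c (m + D i) : ℤ) - c (m + D i - (p * k : ℕ)) - c (m + D i - (Q * k : ℕ))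
      + c (m + D i - (p * k : ℕ) - (Q * k : ℕ))) = 0) : p ≤ n := by
  have hQ : 0 < Q := hp.trans_le hpQ
  set F : ℤ → ℤ := fun m => ∑ i, (c (m + D i) : ℤ) with hF
  -- The vanishing sum says that the difference of `F` with step `Q * k` has period `p * k`.
  have key : ∀ m : ℤ, F m - F (m - (Q * k : ℕ)) =
      F (m - (p * k : ℕ)) - F (m - (p * k : ℕ) - (Q * k : ℕ)) := by
    intro m
    have := h m
    simp only [Finset.sum_add_distrib, Finset.sum_sub_distrib] at this
    have e1 : ∀ i, m + D i - (p * k : ℕ) = m - (p * k : ℕ) + D i := fun i => by ring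
    have e2 : ∀ i, m + D i - (Q * k : ℕ) = m - (Q * k : ℕ) + D i := fun i => by ring
    have e3 : ∀ i, m + D i - (p * k : ℕ) - (Q * k : ℕ) = m - (p * k : ℕ) - (Q * k : ℕ) + D i :=
      fun i => by ring
    simp only [e3] at this
    simp only [e1, e2] at this
    simp only [hF]
    linarith
  have hF0 : ∀ m, 0 ≤ F m := fun m => Finset.sum_nonneg fun i _ => by positivity
  have hpos : ∀ m, 0 < F m → ∃ i, ((p * k * Q : ℕ) : ℤ) ∣ m + D i := by
    intro m hm
    by_contra! hcon
    have : F m = 0 := Finset.sum_eq_zero fun i _ => by rw [hc, if_neg (hcon i)]; rfl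
    omega
  -- many residues with a positive count force many terms
  have count : ∀ (N : ℕ) (s : ℤ) (m : ℤ), (∀ j : ℕ, 0 < F (m - j * s)) →
      (∀ j : ℤ, ((p * k * Q : ℕ) : ℤ) ∣ j * s → (N : ℤ) ∣ j) → N ≤ n := by
    intro N s m hj hs
    choose f hf using fun j : ℕ => hpos _ (hj j)
    have : Function.Injective fun j : Fin N => f j := by
      intro j j' hjj
      have h1 := hf j
      have h2 := hf j'
      simp only at hjj
      rw [hjj] at h1
      have h3 : ((p * k * Q : ℕ) : ℤ) ∣ ((j' : ℤ) - j) * s := by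
        have := dvd_sub h1 h2
        rwa [show m - ((j : ℕ) : ℤ) * s + D (f j') - (m - ((j' : ℕ) : ℤ) * s + D (f j')) =
          ((j' : ℤ) - j) * s by ring] at this
      have h4 := hs _ h3
      have h5 := Int.eq_zero_of_abs_lt_dvd h4 (by rw [abs_lt]; constructor <;> omega)
      ext
      omega
    simpa using Fintype.card_le_of_injective _ this
  -- Either `F` has period `Q * k`, and one positive value spreads over `p` classes modulo `p * k *
  -- Q`; or some difference is nonzero, and it recurs along steps of `p * k`, through `Q` classes.
  by_cases hcase : ∀ m, F m = F (m - (Q * k : ℕ))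
  · have hpos0 : 0 < F (-D ⟨0, hn⟩) := by
      refine Finset.sum_pos' (fun i _ => by positivity) ⟨⟨0, hn⟩, Finset.mem_univ _, ?_⟩
      simp [hc]
    have hall : ∀ j : ℕ, F (-D ⟨0, hn⟩ - j * (Q * k : ℕ)) = F (-D ⟨0, hn⟩) := by
      intro j
      induction j with
      | zero => simp
      | succ j ih =>
        rw [← ih, hcase (-D ⟨0, hn⟩ - j * (Q * k : ℕ))]
        congr 1
        push_cast
        ring
    refine count p (Q * k : ℕ) (-D ⟨0, hn⟩) (fun j => (hall j).symm ▸ hpos0) fun j hj => ?_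
    have : ((Q * k : ℕ) : ℤ) * p ∣ ((Q * k : ℕ) : ℤ) * j := by
      convert hj using 1
      · push_cast; ring
      · ring
    exact Int.dvd_of_mul_dvd_mul_left (by positivity) this
  · push Not at hcase
    obtain ⟨m, hm⟩ := hcase
    have hall : ∀ j : ℕ, F (m - j * (p * k : ℕ)) - F (m - j * (p * k : ℕ) - (Q * k : ℕ)) =
        F m - F (m - (Q * k : ℕ)) := by
      intro j
      induction j with
      | zero => simp
      | succ j ih =>
        rw [← ih, key (m - j * (p * k : ℕ))]
        congr 2 <;> push_cast <;> ring
    have hdvd : ∀ j : ℤ, ((p * k * Q : ℕ) : ℤ) ∣ j * (p * k : ℕ) → (Q : ℤ) ∣ j := by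
      intro j hj
      have : ((p * k : ℕ) : ℤ) * Q ∣ ((p * k : ℕ) : ℤ) * j := by
        convert hj using 1
        · push_cast; ring
        · ring
      exact Int.dvd_of_mul_dvd_mul_left (by positivity) this
    refine hpQ.trans ?_
    -- As `F` is nonnegative, the sign of the recurring difference tells which of its two terms
    -- stays positive.
    rcases lt_or_gt_of_ne hm with hlt | hlt
    · refine count Q (p * k : ℕ) (m - (Q * k : ℕ)) (fun j => ?_) hdvd
      have h1 := hall j
      have h2 := hF0 (m - j * (p * k : ℕ))
      have h3 : m - j * (p * k : ℕ) - (Q * k : ℕ) = m - (Q * k : ℕ) - j * (p * k : ℕ) := by ring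
      rw [h3] at h1
      omega
    · refine count Q (p * k : ℕ) m (fun j => ?_) hdvd
      have h1 := hall j
      have h2 := hF0 (m - j * (p * k : ℕ) - (Q * k : ℕ))
      omega

end Counting

/-! ### Crossed homomorphisms and the algebraic criterion -/

section Cocycle

open scoped commutatorElement

variable {G : Type*} [Group G]

/-- A degree `d : G → ℤ` together with a crossed homomorphism `w` from `G` to the functions
`ℤ → ℂ`, on which `G` acts by translation through `d`. -/
structure DegreeCocycle (G : Type*) [Group G] where
  d : G → ℤ
  w : G → ℤ → ℂ
  d_mul : ∀ g h, d (g * h) = d g + d h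
  w_mul : ∀ g h n, w (g * h) n = w h n + w g (n + d h)

namespace DegreeCocycle

variable (c : DegreeCocycle G)

theorem d_one : c.d 1 = 0 := by simpa using c.d_mul 1 1

theorem w_one (n : ℤ) : c.w 1 n = 0 := by simpa [c.d_one] using c.w_mul 1 1 n

theorem d_inv (g : G) : c.d g⁻¹ = -c.d g := by
  have := c.d_mul g g⁻¹
  rw [mul_inv_cancel, c.d_one] at this
  omega

theorem w_inv (g : G) (n : ℤ) : c.w g⁻¹ n = -c.w g (n - c.d g) := by
  have := c.w_mul g g⁻¹ n
  rw [mul_inv_cancel, c.w_one, c.d_inv, ← sub_eq_add_neg] at this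
  linear_combination -this

theorem d_pow (g : G) (k : ℕ) : c.d (g ^ k) = k * c.d g := by
  induction k with
  | zero => simp [c.d_one]
  | succ k ih => rw [pow_succ, c.d_mul, ih]; push_cast; ring

theorem w_pow_eq_zero {g : G} (h : ∀ n, c.w g n = 0) (k : ℕ) (n : ℤ) : c.w (g ^ k) n = 0 := by
  induction k generalizing n with
  | zero => simp [c.w_one]
  | succ k ih => rw [pow_succ, c.w_mul, h, ih, add_zero]

theorem d_conj (x g : G) : c.d (x * g * x⁻¹) = c.d g := by
  rw [c.d_mul, c.d_mul, c.d_inv]; ring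

/-- In degree zero the contributions of `x` and `x⁻¹` are evaluated at the same point and cancel;
only a translation remains. -/
theorem w_conj (x g : G) (hg : c.d g = 0) (n : ℤ) :
    c.w (x * g * x⁻¹) n = c.w g (n - c.d x) := by
  rw [c.w_mul, c.w_mul, c.w_inv, c.d_inv, hg, add_zero, ← sub_eq_add_neg]
  ring

theorem w_list_prod (l : List G) (hl : ∀ g ∈ l, c.d g = 0) (n : ℤ) :
    c.w l.prod n = (l.map fun g => c.w g n).sum ∧ c.d l.prod = 0 := by
  induction l with
  | nil => simp [c.w_one, c.d_one]
  | cons g l ih =>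
    have ih := ih fun x hx => hl x (List.mem_cons_of_mem _ hx)
    have hg := hl g List.mem_cons_self
    rw [List.prod_cons, c.w_mul, c.d_mul, ih.1, ih.2, hg]
    simp [add_comm]

theorem d_eq_zero_of_mem_commutator {g : G} (hg : g ∈ commutator G) : c.d g = 0 := by
  let f : G →* Multiplicative ℤ :=
    { toFun := fun g => Multiplicative.ofAdd (c.d g)
      map_one' := by rw [c.d_one]; rfl
      map_mul' := fun g h => by rw [c.d_mul]; rfl }
  exact congrArg Multiplicative.toAdd
    (MonoidHom.mem_ker.1 (Abelianization.commutator_subset_ker f hg))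

/-- Degrees vanish on G', so no translation occurs there and `w` restricts to a homomorphism into an
abelian group. -/
theorem w_eq_zero_of_mem_commutator_commutator {g : G}
    (hg : g ∈ ⁅commutator G, commutator G⁆) (n : ℤ) : c.w g n = 0 := by
  let f : commutator G →* Multiplicative ℂ :=
    { toFun := fun g => Multiplicative.ofAdd (c.w g n)
      map_one' := by rw [OneMemClass.coe_one, c.w_one]; rfl
      map_mul' := fun g h => by
        rw [Subgroup.coe_mul, c.w_mul, c.d_eq_zero_of_mem_commutator h.2, add_zero, add_comm]
        rfl }
  have h1 : ⁅commutator G, commutator G⁆ = (commutator (commutator G)).map (commutator G).subtype := by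
    rw [commutator_def (commutator G), Subgroup.map_commutator]
    simp [← MonoidHom.range_eq_map]
  rw [h1] at hg
  obtain ⟨g', hg', rfl⟩ := hg
  exact congrArg Multiplicative.toAdd
    (MonoidHom.mem_ker.1 (Abelianization.commutator_subset_ker f hg'))

end DegreeCocycle

/-- If `u ^ p` commutes with `y`, then a product of `p` conjugates of `⁅u, y⁆` is trivial. -/
theorem mem_genTorsionSpectrum_commutatorElement {u y : G} {p : ℕ} (hp : 0 < p)
    (h : Commute (u ^ p) y) : p ∈ genTorsionSpectrum ⁅u, y⁆ := by
  refine ⟨hp, fun i => u ^ (p - 1 - i : ℕ), ?_⟩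
  -- Telescoping: ⁅u^(n+1), y⁆ = (u^n ⁅u, y⁆ u^(-n)) ⁅u^n, y⁆.
  have key : ∀ n : ℕ, (List.ofFn fun i : Fin n => u ^ (n - 1 - i : ℕ) * ⁅u, y⁆ *
      (u ^ (n - 1 - i : ℕ))⁻¹).prod = ⁅u ^ n, y⁆ := by
    intro n
    induction n with
    | zero => simp
    | succ n ih =>
      rw [List.ofFn_succ, List.prod_cons]
      have : (List.ofFn fun i : Fin n => u ^ (n + 1 - 1 - (i.succ : Fin (n+1)) : ℕ) * ⁅u, y⁆ *
        (u ^ (n + 1 - 1 - (i.succ : Fin (n+1)) : ℕ))⁻¹) = List.ofFn fun i : Fin n =>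
          u ^ (n - 1 - i : ℕ) * ⁅u, y⁆ * (u ^ (n - 1 - i : ℕ))⁻¹ := by
        congr 1
        ext i
        have : n + 1 - 1 - (i.succ : Fin (n+1)) = n - 1 - (i : ℕ) := by
          simp; omega
        rw [this]
      rw [this, ih]
      simp only [Fin.val_zero, commutatorElement_def, Nat.add_sub_cancel, Nat.sub_zero, pow_succ]
      group
  rw [key, commutatorElement_eq_one_iff_commute]
  exact h

/-- The algebraic criterion for a generalized torsion element of order `p` outside `G''`. -/
theorem DegreeCocycle.exists_gord_eq (c : DegreeCocycle G) {p k Q : ℕ} (hp1 : 1 < p) (hk : 0 < k)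
    (hpQ : p < Q) (hco : Nat.Coprime (p * k) Q) {x y : G}
    (hxy : Commute (x ^ (p * k)) y) (hdx : c.d x = Q) (hwx : ∀ n, c.w x n = 0)
    (hdy : c.d y = (p * k : ℕ)) (z : ℂ) (hz : z ≠ 0) (b : ℤ → ℂ)
    (hb : ∀ n, b n = if ((p * k * Q : ℕ) : ℤ) ∣ n then z else 0)
    (hwy : ∀ n, c.w y n = b n - b (n + (p * k : ℕ))) :
    ∃ g : G, IsGenTorsion g ∧ gord g = (p : ℕ∞) ∧ g ∉ ⁅commutator G, commutator G⁆ := by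
  -- The exponent `k` is chosen so that the `p`-th power of `x ^ k` is `x ^ (p * k)`, which commutes
  -- with `y`.
  set g : G := ⁅x ^ k, y⁆ with hg
  have hQ : 1 < Q := by omega
  have hp : 0 < p := by omega
  have hpk : 0 < p * k := by positivity
  have hdg : c.d g = 0 :=
    c.d_eq_zero_of_mem_commutator (Subgroup.commutator_mem_commutator (Subgroup.mem_top _) (Subgroup.mem_top _))
  have hwg : ∀ n, c.w g n = b n - b (n - (p * k : ℕ)) - b (n - (Q * k : ℕ)) +
      b (n - (p * k : ℕ) - (Q * k : ℕ)) := by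
    intro n
    have h0 := c.w_pow_eq_zero hwx k
    rw [hg, commutatorElement_def, c.w_mul, c.w_mul, c.w_mul, c.w_inv, c.w_inv, h0, h0, c.d_inv,
      c.d_inv, c.d_pow, hdx, hdy, hwy, hwy]
    have e1 : n - ((p * k : ℕ) : ℤ) + (p * k : ℕ) = n := by ring
    have e2 : n + -((p * k : ℕ) : ℤ) + -(k * Q) = n - (p * k : ℕ) - (Q * k : ℕ) := by
      push_cast; ring
    have e3 : n - ((p * k : ℕ) : ℤ) - (Q * k : ℕ) + (p * k : ℕ) = n - (Q * k : ℕ) := by ring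
    rw [e1, e2, e3]
    ring
  have hmem : p ∈ genTorsionSpectrum g :=
    mem_genTorsionSpectrum_commutatorElement hp (by rwa [← pow_mul, mul_comm])
  -- Only the first term of the second difference survives at 0. For the two shifts involving `p *
  -- k`, divisibility would give `Q ∣ p * k`, against coprimality; and `Q * k` is too small to be a
  -- multiple of `p * k * Q`.
  have hwg0 : c.w g 0 ≠ 0 := by
    have hdQ : (Q : ℤ) ∣ ((p * k * Q : ℕ) : ℤ) := ⟨(p * k : ℕ), by push_cast; ring⟩
    have hdP : ((p * k : ℕ) : ℤ) ∣ ((p * k * Q : ℕ) : ℤ) := ⟨Q, by push_cast; ring⟩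
    have hQpk : ¬ (Q : ℤ) ∣ ((p * k : ℕ) : ℤ) := fun h => by
      have := Nat.Coprime.eq_one_of_dvd hco.symm (Int.natCast_dvd_natCast.1 h)
      omega
    have hn1 : ¬ ((p * k * Q : ℕ) : ℤ) ∣ 0 - (p * k : ℕ) := fun h => by
      rw [zero_sub, dvd_neg] at h
      exact hQpk (hdQ.trans h)
    have hn3 : ¬ ((p * k * Q : ℕ) : ℤ) ∣ 0 - (p * k : ℕ) - (Q * k : ℕ) := fun h => by
      have h1 := (hdQ.trans h).add (⟨k, by push_cast; ring⟩ : (Q : ℤ) ∣ (Q * k : ℕ))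
      rw [sub_add_cancel, zero_sub, dvd_neg] at h1
      exact hQpk h1
    rw [hwg, hb, hb, hb, hb, if_pos (dvd_zero _), if_neg hn1, if_neg hn3]
    have hn2 : ¬ ((p * k * Q : ℕ) : ℤ) ∣ 0 - (Q * k : ℕ) := fun h => by
      rw [zero_sub, dvd_neg, Int.natCast_dvd_natCast] at h
      have := Nat.le_of_dvd (by positivity) h
      nlinarith [Nat.mul_lt_mul_of_pos_right hp1 (show 0 < k * Q by positivity)]
    rw [if_neg hn2]
    simpa using hz
  have hg1 : g ≠ 1 := fun h => hwg0 (by rw [h, c.w_one])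
  refine ⟨g, ⟨hg1, ⟨p, hmem⟩⟩, ?_, fun h => hwg0 (c.w_eq_zero_of_mem_commutator_commutator h 0)⟩
  refine le_antisymm (iInf₂_le p hmem) (le_iInf₂ fun n hn => ?_)
  obtain ⟨hn0, X, hX⟩ := hn
  refine Nat.cast_le.2 (le_of_sum_second_difference_eq_zero hpQ.le hk hp hn0 (fun i => -c.d (X i))
    (fun m => if ((p * k * Q : ℕ) : ℤ) ∣ m then 1 else 0) (fun _ => rfl) fun m => ?_)
  have h1 := (c.w_list_prod (List.ofFn fun i => X i * g * (X i)⁻¹) (by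
    intro y hy
    obtain ⟨i, rfl⟩ := (List.mem_ofFn' _ _).1 hy
    rw [c.d_conj, hdg]) m).1
  rw [hX, c.w_one, List.map_ofFn, List.sum_ofFn] at h1
  simp only [Function.comp_apply, c.w_conj _ _ hdg, hwg, sub_eq_add_neg] at h1
  -- Factoring out `z` turns the complex identity into the integer one required by the counting
  -- argument.
  have hb' : ∀ n, b n = z * ((if ((p * k * Q : ℕ) : ℤ) ∣ n then 1 else 0 : ℤ) : ℂ) := by
    intro n; rw [hb]; split_ifs <;> simp
  have h2 : z * ((∑ i, (((if ((p * k * Q : ℕ) : ℤ) ∣ m + -c.d (X i) then 1 else 0 : ℕ) : ℤ) -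
      (if ((p * k * Q : ℕ) : ℤ) ∣ m + -c.d (X i) - (p * k : ℕ) then 1 else 0 : ℕ) -
      (if ((p * k * Q : ℕ) : ℤ) ∣ m + -c.d (X i) - (Q * k : ℕ) then 1 else 0 : ℕ) +
      (if ((p * k * Q : ℕ) : ℤ) ∣ m + -c.d (X i) - (p * k : ℕ) - (Q * k : ℕ) then 1 else 0 : ℕ) :
      ℤ) : ℤ) : ℂ) = 0 := by
    rw [h1, Int.cast_sum, Finset.mul_sum]
    refine Finset.sum_congr rfl fun i _ => ?_
    simp only [hb', sub_eq_add_neg]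
    push_cast
    ring
  exact Int.cast_eq_zero.1 ((mul_eq_zero.1 h2).resolve_left hz)

end Cocycle

/-! ### Continuous logarithms and their uniqueness -/

section Logarithms

open unitInterval

variable {A : Type*} [TopologicalSpace A]

instance contractibleSpace_unitInterval : ContractibleSpace I :=
  (convex_Icc (0 : ℝ) 1).contractibleSpace ⟨0, by simp⟩

/-- A nonvanishing function lifts along a homotopy, starting from a logarithm at time `0`. -/
theorem exists_log_of_homotopy (H : C(I × A, ℂ)) (hH : ∀ q, H q ≠ 0) (L₀ : C(A, ℂ))
    (h₀ : ∀ a, Complex.exp (L₀ a) = H (0, a)) :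
    ∃ L : C(I × A, ℂ), (∀ q, Complex.exp (L q) = H q) ∧ ∀ a, L (0, a) = L₀ a := by
  let H' : C(I × A, {z : ℂ // z ≠ 0}) := ⟨fun q => ⟨H q, hH q⟩, by fun_prop⟩
  have hH' : ∀ a, H' (0, a) = (fun z : ℂ => (⟨_, z.exp_ne_zero⟩ : {z : ℂ // z ≠ 0})) (L₀ a) :=
    fun a => Subtype.ext (h₀ a).symm
  refine ⟨Complex.isCoveringMap_exp.liftHomotopy H' L₀ hH', fun q => ?_, fun a => ?_⟩
  · exact congrArg Subtype.val
      (congrFun (Complex.isCoveringMap_exp.liftHomotopy_lifts H' L₀ hH') q)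
  · exact Complex.isCoveringMap_exp.liftHomotopy_zero H' L₀ hH' a

/-- A nonvanishing continuous function on a contractible space has a continuous logarithm. -/
theorem exists_log_of_contractible [ContractibleSpace A] (f : C(A, ℂ)) (hf : ∀ a, f a ≠ 0) :
    ∃ L : C(A, ℂ), ∀ a, Complex.exp (L a) = f a := by
  -- The reversed contraction starts at a constant map, where a logarithm is available, and ends at
  -- the identity.
  obtain ⟨a₀, ⟨N⟩⟩ := id_nullhomotopic A
  obtain ⟨L, hL, -⟩ := exists_log_of_homotopy (f.comp N.symm.toContinuousMap) (fun q => hf _)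
    (ContinuousMap.const A (Complex.log (f a₀))) (fun a => by simp [Complex.exp_log (hf a₀)])
  refine ⟨L.comp ⟨fun a => (1, a), by fun_prop⟩, fun a => ?_⟩
  simp [hL]

/-- Two continuous logarithms of the same function that agree at one point agree everywhere, on a
preconnected space. -/
theorem log_unique [PreconnectedSpace A] {L L' : A → ℂ} (hL : Continuous L) (hL' : Continuous L')
    (h : ∀ a, Complex.exp (L a) = Complex.exp (L' a)) (a₀ : A) (h₀ : L a₀ = L' a₀) : L = L' :=
  Complex.isCoveringMap_exp.eq_of_comp_eq hL hL' (funext fun a => Subtype.ext (h a)) a₀ h₀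

/-- Two continuous logarithms of the same function have a constant difference, on a preconnected
space. -/
theorem log_sub_log_eq [PreconnectedSpace A] {L L' : A → ℂ} (hL : Continuous L)
    (hL' : Continuous L') (h : ∀ a, Complex.exp (L a) = Complex.exp (L' a)) (a b : A) :
    L a - L' a = L b - L' b := by
  have h1 : (fun x => L x - L' x) = fun _ => L b - L' b :=
    log_unique (hL.sub hL') continuous_const
      (fun x => by rw [Complex.exp_sub, Complex.exp_sub, h, h]; simp [Complex.exp_ne_zero]) b rfl
  exact congrFun h1 a

/-- Logarithms along the two ends of a homotopy of paths with fixed end points extend to the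
homotopy. -/
theorem exists_log_square (G : C(I × I, ℂ)) (hG : ∀ q, G q ≠ 0)
    (h0 : ∀ s, G (s, 0) = G (0, 0)) {L L' : I → ℂ} (hL : Continuous L)
    (hL' : Continuous L') (hGL : ∀ t, Complex.exp (L t) = G (0, t))
    (hGL' : ∀ t, Complex.exp (L' t) = G (1, t)) (h : L 0 = L' 0) :
    ∃ M : C(I × I, ℂ), (∀ q, Complex.exp (M q) = G q) ∧ (∀ t, M (0, t) = L t) ∧
      ∀ t, M (1, t) = L' t := by
  obtain ⟨M, hM, hM0⟩ := exists_log_of_homotopy G hG ⟨L, hL⟩ hGL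
  -- On the edge t = 0 the function is constant, hence so is its logarithm; this makes `M (1, ·)`
  -- and `L'` start at the same value.
  have e0 : (fun s => M (s, 0)) = fun _ => L 0 :=
    log_unique (by fun_prop) continuous_const (fun s => by rw [hM, h0, hGL]) 0 (hM0 0)
  refine ⟨M, hM, hM0, fun t => ?_⟩
  exact congrFun (log_unique (L := fun t => M (1, t)) (by fun_prop) hL'
    (fun t => by rw [hM, hGL']) 0 ((congrFun e0 1).trans h)) t

theorem log_square_end {M : C(I × I, ℂ)} (h1 : ∀ s, Complex.exp (M (s, 1)) =
    Complex.exp (M (0, 1))) : M (1, 1) = M (0, 1) :=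
  congrFun (log_unique (L := fun s => M (s, 1)) (L' := fun _ => M (0, 1)) (by fun_prop)
    continuous_const h1 0 rfl) 1

end Logarithms

/-! ### Monodromy of two successive logarithms -/

section PathLifting

open unitInterval

variable {X : Type*} [TopologicalSpace X] (F : C(X, ℂ))
  (H : C({q : X × ℂ // Complex.exp q.2 = F q.1}, ℂ))

/-- `LiftsTo F H γ τ τ' r`: along the path `γ`, the logarithm of `F` that starts at `τ` ends at `τ'`,
and the logarithm of `H` along the resulting path changes by `r`. -/
def LiftsTo {x y : X} (γ : Path x y) (τ τ' r : ℂ) : Prop :=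
  ∃ (s s' : ℂ) (L : Path τ τ') (θ : Path s s') (hL : ∀ t, Complex.exp (L t) = F (γ t)),
    (∀ t, Complex.exp (θ t) = H ⟨(γ t, L t), hL t⟩) ∧ r = s' - s

variable {F H}

theorem LiftsTo.trans {x y z : X} {γ : Path x y} {γ' : Path y z} {τ τ' τ'' r r' : ℂ}
    (h : LiftsTo F H γ τ τ' r) (h' : LiftsTo F H γ' τ' τ'' r') :
    LiftsTo F H (γ.trans γ') τ τ'' (r + r') := by
  obtain ⟨s, s', L, θ, hL, hθ, rfl⟩ := h
  obtain ⟨u, u', L', θ', hL', hθ', rfl⟩ := h'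
  have hs : Complex.exp s' = Complex.exp u := by
    have h1 := hθ 1
    have h2 := hθ' 0
    simp only [Path.target, Path.source] at h1 h2
    rw [h1, h2]
  -- The two logarithms of `H` may differ at the junction by a period; shifting the second one makes
  -- them match and leaves its increment unchanged.
  let θ'' : Path s' (u' - u + s') :=
    (θ'.map (f := fun w => w - u + s') (by fun_prop)).cast (by simp) rfl
  have hθ'' : ∀ t, Complex.exp (θ'' t) = H ⟨(γ' t, L' t), hL' t⟩ := fun t => by
    rw [← hθ']
    change Complex.exp (θ' t - u + s') = _
    rw [Complex.exp_add, Complex.exp_sub, hs]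
    field_simp [Complex.exp_ne_zero]
  have hLL : ∀ t, Complex.exp ((L.trans L') t) = F ((γ.trans γ') t) := fun t => by
    rw [Path.trans_apply, Path.trans_apply]
    split_ifs
    exacts [hL _, hL' _]
  refine ⟨s, u' - u + s', L.trans L', θ.trans θ'', hLL, fun t => ?_, by ring⟩
  rw [Path.trans_apply]
  simp only [Path.trans_apply (γ := γ), Path.trans_apply (γ := L)]
  split_ifs
  exacts [hθ _, hθ'' _]

theorem LiftsTo.symm {x y : X} {γ : Path x y} {τ τ' r : ℂ} (h : LiftsTo F H γ τ τ' r) :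
    LiftsTo F H γ.symm τ' τ (-r) := by
  obtain ⟨s, s', L, θ, hL, hθ, rfl⟩ := h
  exact ⟨s', s, L.symm, θ.symm, fun t => hL _, fun t => hθ _, by ring⟩

/-- Homotopy lifting is used twice: the logarithm of `F` carries the homotopy to the infinite cyclic
cover with its end points fixed, and then the logarithm of `H` extends over the lifted homotopy. -/
theorem LiftsTo.eq_of_homotopic {x y : X} {γ γ' : Path x y} {τ τ₁ τ₂ r₁ r₂ : ℂ}
    (hF : ∀ x, F x ≠ 0) (hH : ∀ q, H q ≠ 0) (h : LiftsTo F H γ τ τ₁ r₁) (h' : LiftsTo F H γ' τ τ₂ r₂)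
    (hγ : γ.Homotopic γ') : τ₁ = τ₂ ∧ r₁ = r₂ := by
  obtain ⟨s, s', L, θ, hL, hθ, rfl⟩ := h
  obtain ⟨u, u', L', θ', hL', hθ', rfl⟩ := h'
  obtain ⟨K⟩ := hγ
  have hFK : ∀ q, (F.comp K.toContinuousMap) q = F (K q) := fun q => rfl
  have hne : ∀ q, (F.comp K.toContinuousMap) q ≠ 0 := fun q => hF _
  obtain ⟨M, hM, hM0, hM1⟩ := exists_log_square (F.comp K.toContinuousMap) hne
    (fun s => by simp) L.continuous L'.continuous (fun t => by simp [hL]) (fun t => by simp [hL'])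
    (by simp)
  have hMend : ∀ s, M (s, 1) = τ₁ := fun s => by
    have : (fun s => M (s, 1)) = fun _ => τ₁ :=
      log_unique (by fun_prop) continuous_const
        (fun s => by rw [hM, hFK, ← L.target, hL]; simp) 0 (by simp [hM0])
    exact congrFun this s
  have hMstart : ∀ s, M (s, 0) = τ := fun s => by
    have : (fun s => M (s, 0)) = fun _ => τ :=
      log_unique (by fun_prop) continuous_const
        (fun s => by rw [hM, hFK, ← L.source, hL]; simp) 0 (by simp [hM0])
    exact congrFun this s
  have hτ : τ₁ = τ₂ := by rw [← hMend 1, hM1, L'.target]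
  refine ⟨hτ, ?_⟩
  let N : C(I × I, ℂ) := ⟨fun q => H ⟨(K q, M q), (hM q).trans (hFK q)⟩, by fun_prop⟩
  have hN : ∀ q, N q = H ⟨(K q, M q), (hM q).trans (hFK q)⟩ := fun q => rfl
  have hsu : Complex.exp s = Complex.exp u := by
    rw [← θ.source, ← θ'.source, hθ, hθ']
    simp
  obtain ⟨R, hR, hR0, hR1⟩ := exists_log_square N (fun q => hH _) (fun s => by simp [hN, hMstart])
    (L := θ) (L' := fun t => θ' t - u + s) θ.continuous (by fun_prop)
    (fun t => by simp [hN, hM0, hθ])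
    (fun t => by
      rw [Complex.exp_add, Complex.exp_sub, hsu, div_mul_cancel₀ _ (Complex.exp_ne_zero _), hθ']
      simp [hN, hM1])
    (by simp)
  have := log_square_end (M := R) (fun s => by rw [hR, hR]; simp [hN, hMend])
  rw [hR0, hR1, θ.target, θ'.target] at this
  rw [← this]
  ring

theorem exists_liftsTo (hF : ∀ x, F x ≠ 0) (hH : ∀ q, H q ≠ 0) {x y : X} (γ : Path x y) (τ : ℂ)
    (hτ : Complex.exp τ = F x) : ∃ τ' r, LiftsTo F H γ τ τ' r := by
  obtain ⟨L₀, hL₀⟩ := exists_log_of_contractible (F.comp γ.toContinuousMap) (fun t => hF _)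
  have h1 : Complex.exp (L₀ 0) = F x := by simp [hL₀]
  let L : Path τ (L₀ 1 - L₀ 0 + τ) := ⟨⟨fun t => L₀ t - L₀ 0 + τ, by fun_prop⟩, by simp, by simp⟩
  have hL : ∀ t, Complex.exp (L t) = F (γ t) := fun t => by
    change Complex.exp (L₀ t - L₀ 0 + τ) = _
    rw [Complex.exp_add, Complex.exp_sub, h1, hτ, div_mul_cancel₀ _ (hF _), hL₀]
    rfl
  obtain ⟨θ, hθ⟩ := exists_log_of_contractible
    (⟨fun t => H ⟨(γ t, L t), hL t⟩, by fun_prop⟩ : C(I, ℂ)) (fun t => hH _)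
  exact ⟨_, _, θ 0, θ 1, L, ⟨θ, rfl, rfl⟩, hL, hθ, rfl⟩

theorem LiftsTo.exp_right {x y : X} {γ : Path x y} {τ τ' r : ℂ} (h : LiftsTo F H γ τ τ' r) :
    Complex.exp τ' = F y := by
  obtain ⟨s, s', L, θ, hL, hθ, rfl⟩ := h
  simpa using hL 1

/-- The shift by `v` is a deck transformation of the cover. It preserves `F` but not `H`, so the new
increment `r'` is unrelated to `r`; this is why the cocycle takes values in functions on ℤ. -/
theorem LiftsTo.shift (hH : ∀ q, H q ≠ 0) {x y : X} {γ : Path x y}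
    {τ τ' r : ℂ} (h : LiftsTo F H γ τ τ' r) (v : ℂ) (hv : Complex.exp v = 1) :
    ∃ r', LiftsTo F H γ (τ + v) (τ' + v) r' := by
  have hL : ∀ τ, Complex.exp (τ + v) = Complex.exp τ := fun τ => by
    rw [Complex.exp_add, hv, mul_one]
  obtain ⟨s, s', L, θ, hL', hθ, rfl⟩ := h
  have hL'' : ∀ t, Complex.exp ((L.map (f := (· + v)) (by fun_prop)) t) = F (γ t) := fun t => by
    rw [Path.map_coe, Function.comp_apply, hL, hL']
  obtain ⟨θ, hθ⟩ := exists_log_of_contractible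
    (⟨fun t => H ⟨(γ t, (L.map (f := (· + v)) (by fun_prop)) t), hL'' t⟩, by fun_prop⟩ : C(I, ℂ))
    (fun t => hH _)
  exact ⟨_, θ 0, θ 1, L.map (f := (· + v)) (by fun_prop), ⟨θ, rfl, rfl⟩, hL'', hθ, rfl⟩

/-- The degree cocycle on the fundamental group given by the monodromy of the logarithms of `F`
and `H`. -/
theorem exists_degreeCocycle (hF : ∀ x, F x ≠ 0) (hH : ∀ q, H q ≠ 0) (x : X) (hx : F x = 1) :
    ∃ c : DegreeCocycle (FundamentalGroup X x), ∀ (γ : Path x x) (n m : ℤ) (r : ℂ),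
      LiftsTo F H γ (n * (2 * Real.pi * Complex.I)) (m * (2 * Real.pi * Complex.I)) r →
      c.d (FundamentalGroup.fromPath (Path.Homotopic.Quotient.mk γ)) = m - n ∧
      c.w (FundamentalGroup.fromPath (Path.Homotopic.Quotient.mk γ)) n = r := by
  set e : ℤ → ℂ := fun n => n * (2 * Real.pi * Complex.I) with he
  have e_inj : Function.Injective e := fun a b h => by
    have h0 := Complex.two_pi_I_ne_zero
    simpa [he, h0] using h
  have e_add : ∀ a b, e (a + b) = e a + e b := fun a b => by simp [he]; ring
  have hexp : ∀ n, Complex.exp (e n) = F x := fun n => by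
    rw [hx, Complex.exp_eq_one_iff]; exact ⟨n, rfl⟩
  have hrep : ∀ g : FundamentalGroup X x, ∃ γ : Path x x,
      g = FundamentalGroup.fromPath (Path.Homotopic.Quotient.mk γ) := fun g => by
    obtain ⟨γ, hγ⟩ := Path.Homotopic.Quotient.mk_surjective (FundamentalGroup.toPath g)
    exact ⟨γ, hγ.symm⟩
  choose rep hrep using hrep
  -- By deck transformations, the degree found on level 0 is the same on every level.
  have hex : ∀ γ : Path x x, ∃ d : ℤ, ∀ n, ∃ r, LiftsTo F H γ (e n) (e (n + d)) r := by
    intro γ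
    obtain ⟨τ', r, h⟩ := exists_liftsTo hF hH γ (e 0) (hexp 0)
    obtain ⟨d, hd⟩ := Complex.exp_eq_one_iff.1 (h.exp_right.trans hx)
    refine ⟨d, fun n => ?_⟩
    obtain ⟨r', h'⟩ := h.shift hH (e n) ((hexp n).trans hx)
    refine ⟨r', ?_⟩
    convert h' using 1
    · rw [← e_add, zero_add]
    · rw [e_add, hd, add_comm]
  choose d r hr using hex
  have key : ∀ (γ γ' : Path x x), γ.Homotopic γ' → ∀ n m (s : ℂ), LiftsTo F H γ' (e n) (e m) s →
      d γ = m - n ∧ r γ n = s := by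
    intro γ γ' hγ n m s h
    have h1 := (hr γ n).eq_of_homotopic hF hH h hγ
    have h2 := e_inj h1.1
    exact ⟨by omega, h1.2⟩
  -- A product `g * h` runs through `h` first, so the lift of `g` starts on level `n + d h`, as in
  -- `w_mul`.
  have hmul : ∀ g h, (rep (g * h)).Homotopic ((rep h).trans (rep g)) := fun g h => by
    rw [← Path.Homotopic.Quotient.eq, Path.Homotopic.Quotient.mk_trans]
    have h1 := hrep (g * h)
    rw [FundamentalGroup.mul_def] at h1
    nth_rewrite 1 [hrep h] at h1
    nth_rewrite 1 [hrep g] at h1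
    exact h1.symm
  have htr : ∀ g h n, LiftsTo F H ((rep h).trans (rep g)) (e n) (e (n + d (rep h) + d (rep g)))
      (r (rep h) n + r (rep g) (n + d (rep h))) := fun g h n =>
    (hr (rep h) n).trans (hr (rep g) (n + d (rep h)))
  refine ⟨⟨fun g => d (rep g), fun g n => r (rep g) n, fun g h => ?_, fun g h n => ?_⟩,
    fun γ n m s hs => ?_⟩
  · rw [(key _ _ (hmul g h) _ _ _ (htr g h 0)).1]; ring
  · exact (key _ _ (hmul g h) _ _ _ (htr g h n)).2
  · exact key _ _ (Path.Homotopic.Quotient.eq.1 (hrep _).symm) n m s hs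

end PathLifting

/-! ### A multiplicative Mayer–Vietoris argument -/

section Splitting

variable {X : Type*} [TopologicalSpace X]

/-- On `A`, the nonvanishing function `c` on `U ∩ V` is the product of a nonvanishing function on
`U` and one on `V`. -/
def SplitsOn (U V : Set X) (c : X → ℂ) (A : Set X) : Prop :=
  ∃ a b : X → ℂ, ContinuousOn a (A ∩ U) ∧ ContinuousOn b (A ∩ V) ∧ (∀ x ∈ A ∩ U, a x ≠ 0) ∧
    (∀ x ∈ A ∩ V, b x ≠ 0) ∧ ∀ x ∈ A ∩ (U ∩ V), c x = a x * b x

/-- Every nonvanishing continuous function on `A` has a continuous logarithm. -/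
def HasLogs (A : Set X) : Prop :=
  ∀ f : X → ℂ, ContinuousOn f A → (∀ x ∈ A, f x ≠ 0) →
    ∃ L : X → ℂ, ContinuousOn L A ∧ ∀ x ∈ A, Complex.exp (L x) = f x

/-- The logarithm is taken on the contractible space `Z` and pulled back along the section `i` of
`r`. -/
theorem hasLogs_of_retract {Z : Type*} [TopologicalSpace Z] [ContractibleSpace Z] {A : Set X}
    (r : C(Z, X)) (hr : ∀ z, r z ∈ A) (i : X → Z) (hi : ContinuousOn i A)
    (hri : ∀ x ∈ A, r (i x) = x) : HasLogs A := by
  intro f hf hf0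
  obtain ⟨L, hL⟩ := exists_log_of_contractible
    (⟨fun z => f (r z), hf.comp_continuous r.continuous hr⟩ : C(Z, ℂ)) (fun z => hf0 _ (hr z))
  refine ⟨fun x => L (i x), L.continuous.comp_continuousOn hi, fun x hx => ?_⟩
  rw [hL]
  exact congrArg f (hri x hx)

theorem hasLogs_of_contractible {A : Set X} [ContractibleSpace A] : HasLogs A := by
  classical
  obtain ⟨a₀⟩ : Nonempty A := inferInstance
  refine hasLogs_of_retract (⟨Subtype.val, by fun_prop⟩ : C(A, X)) (fun z => z.2)
    (fun x => if h : x ∈ A then ⟨x, h⟩ else a₀) ?_ (fun x hx => by simp [hx])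
  rw [continuousOn_iff_continuous_domRestrict]
  convert continuous_id (X := A) using 1
  ext x
  simp

theorem continuousOn_union_inter {Y : Type*} [TopologicalSpace Y] {A B U : Set X}
    (hA : IsClosed A) (hB : IsClosed B) {f : X → Y} (h : ContinuousOn f (A ∩ U))
    (h' : ContinuousOn f (B ∩ U)) : ContinuousOn f ((A ∪ B) ∩ U) := by
  intro x hx
  rw [Set.union_inter_distrib_right, continuousWithinAt_union]
  constructor
  · by_cases hxA : x ∈ A
    · exact h x ⟨hxA, hx.2⟩
    · exact continuousWithinAt_of_notMem_closure fun hc =>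
        hxA (hA.closure_subset_iff.2 Set.inter_subset_left hc)
  · by_cases hxB : x ∈ B
    · exact h' x ⟨hxB, hx.2⟩
    · exact continuousWithinAt_of_notMem_closure fun hc =>
        hxB (hB.closure_subset_iff.2 Set.inter_subset_left hc)

/-- On the connected intersection two logarithms differ by a constant period, which is absorbed into
one of them. -/
theorem HasLogs.union {A B : Set X} (hA : IsClosed A) (hB : IsClosed B)
    (hAB : IsPreconnected (A ∩ B)) (h : HasLogs A) (h' : HasLogs B) : HasLogs (A ∪ B) := by
  classical
  intro f hf hf0
  obtain ⟨L, hL, hLf⟩ := h f (hf.mono Set.subset_union_left) fun x hx => hf0 x (Or.inl hx)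
  obtain ⟨M, hM, hMf⟩ := h' f (hf.mono Set.subset_union_right) fun x hx => hf0 x (Or.inr hx)
  obtain ⟨k, hk, hkA⟩ : ∃ k : ℂ, Complex.exp k = 1 ∧ ∀ x ∈ A ∩ B, L x = M x + k := by
    rcases (A ∩ B).eq_empty_or_nonempty with he | ⟨x₀, hx₀⟩
    · exact ⟨0, Complex.exp_zero, fun x hx => absurd hx (by simp [he])⟩
    · refine ⟨L x₀ - M x₀, ?_, fun x hx => ?_⟩
      · rw [Complex.exp_sub, hLf _ hx₀.1, hMf _ hx₀.2, div_self (hf0 _ (Or.inl hx₀.1))]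
      · have : PreconnectedSpace ↥(A ∩ B) := Subtype.preconnectedSpace hAB
        have := log_sub_log_eq (A := ↥(A ∩ B)) (L := fun x => L x) (L' := fun x => M x)
          (hL.comp_continuous (by fun_prop) fun x => x.2.1)
          (hM.comp_continuous (by fun_prop) fun x => x.2.2)
          (fun x => by rw [hLf _ x.2.1, hMf _ x.2.2]) ⟨x, hx⟩ ⟨x₀, hx₀⟩
        simp only at this
        linear_combination this
  set N : X → ℂ := fun x => if x ∈ A then L x else M x + k with hN
  have hNA : Set.EqOn N L A := fun x hx => if_pos hx
  have hNB : Set.EqOn N (fun x => M x + k) B := fun x hx => by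
    by_cases hxA : x ∈ A
    · rw [hNA hxA, hkA x ⟨hxA, hx⟩]
    · exact if_neg hxA
  refine ⟨N, ?_, ?_⟩
  · have := continuousOn_union_inter (U := Set.univ) hA hB (f := N)
      (by simpa using hL.congr hNA) (by simpa using (hM.add continuousOn_const).congr hNB)
    simpa using this
  · rintro x (hx | hx)
    · rw [hNA hx, hLf x hx]
    · rw [hNB hx, Complex.exp_add, hk, mul_one, hMf x hx]

/-- Over A ∩ B two splittings differ by one nonvanishing function q, equal to a / a' on U and to b'
/ b on V. These agree on U ∩ V, so q is defined on all of A ∩ B. A logarithm of q, extended to the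
whole space, corrects the second splitting. -/
theorem SplitsOn.union [NormalSpace X] {U V : Set X} (hU : IsOpen U) (hV : IsOpen V)
    (hUV : U ∪ V = Set.univ) {c : X → ℂ} {A B : Set X} (hA : IsClosed A) (hB : IsClosed B)
    (hAB : HasLogs (A ∩ B)) (h : SplitsOn U V c A) (h' : SplitsOn U V c B) :
    SplitsOn U V c (A ∪ B) := by
  classical
  obtain ⟨a, b, ha, hb, ha0, hb0, hab⟩ := h
  obtain ⟨a', b', ha', hb', ha0', hb0', hab'⟩ := h'
  set q : X → ℂ := fun x => if x ∈ U then a x / a' x else b' x / b x with hq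
  have hqU : Set.EqOn q (fun x => a x / a' x) (A ∩ B ∩ U) := fun x hx => if_pos hx.2
  have hqV : Set.EqOn q (fun x => b' x / b x) (A ∩ B ∩ V) := fun x hx => by
    by_cases hxU : x ∈ U
    · rw [hqU ⟨hx.1, hxU⟩]
      have h1 := hab x ⟨hx.1.1, hxU, hx.2⟩
      rw [hab' x ⟨hx.1.2, hxU, hx.2⟩] at h1
      have h2 := ha0' x ⟨hx.1.2, hxU⟩
      have h3 := hb0 x ⟨hx.1.1, hx.2⟩
      field_simp
      linear_combination -h1
    · exact if_neg hxU
  have hcase : ∀ x : X, x ∈ U ∨ x ∈ V := fun x => by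
    have : x ∈ U ∪ V := hUV ▸ Set.mem_univ x
    exact this
  have hqc : ContinuousOn q (A ∩ B) := by
    intro x hx
    rcases hcase x with hxU | hxV
    · have : ContinuousOn q (A ∩ B ∩ U) := ContinuousOn.congr
        ((ha.mono fun y hy => ⟨hy.1.1, hy.2⟩).div (ha'.mono fun y hy => ⟨hy.1.2, hy.2⟩)
          fun y hy => ha0' y ⟨hy.1.2, hy.2⟩) hqU
      exact (continuousWithinAt_inter (hU.mem_nhds hxU)).1 (this x ⟨hx, hxU⟩)
    · have : ContinuousOn q (A ∩ B ∩ V) := ContinuousOn.congr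
        ((hb'.mono fun y hy => ⟨hy.1.2, hy.2⟩).div (hb.mono fun y hy => ⟨hy.1.1, hy.2⟩)
          fun y hy => hb0 y ⟨hy.1.1, hy.2⟩) hqV
      exact (continuousWithinAt_inter (hV.mem_nhds hxV)).1 (this x ⟨hx, hxV⟩)
  have hq0 : ∀ x ∈ A ∩ B, q x ≠ 0 := by
    intro x hx
    rcases hcase x with hxU | hxV
    · rw [hqU ⟨hx, hxU⟩]
      exact div_ne_zero (ha0 x ⟨hx.1, hxU⟩) (ha0' x ⟨hx.2, hxU⟩)
    · rw [hqV ⟨hx, hxV⟩]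
      exact div_ne_zero (hb0' x ⟨hx.2, hxV⟩) (hb0 x ⟨hx.1, hxV⟩)
  obtain ⟨L, hL, hLq⟩ := hAB q hqc hq0
  -- Tietze applies to the logarithm; q itself need not extend without zeros.
  obtain ⟨M, hM⟩ := ContinuousMap.exists_restrict_eq (hA.inter hB)
    (⟨(A ∩ B).domRestrict L, hL.domRestrict⟩ : C(↥(A ∩ B), ℂ))
  have hMq : ∀ x ∈ A ∩ B, Complex.exp (M x) = q x := fun x hx => by
    rw [← hLq x hx]
    exact congrArg Complex.exp (DFunLike.congr_fun hM ⟨x, hx⟩)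
  set α : X → ℂ := fun x => if x ∈ A then a x else a' x * Complex.exp (M x) with hα
  set β : X → ℂ := fun x => if x ∈ A then b x else b' x / Complex.exp (M x) with hβ
  have e1A : Set.EqOn α a (A ∩ U) :=
    fun x hx => if_pos hx.1
  have e1B : Set.EqOn α
      (fun x => a' x * Complex.exp (M x)) (B ∩ U) := fun x hx => by
    by_cases hxA : x ∈ A
    · simp only [hα, if_pos hxA]
      rw [hMq x ⟨hxA, hx.1⟩, hqU ⟨⟨hxA, hx.1⟩, hx.2⟩, mul_div_cancel₀ _ (ha0' x hx)]
    · exact if_neg hxA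
  have e2A : Set.EqOn β b (A ∩ V) :=
    fun x hx => if_pos hx.1
  have e2B : Set.EqOn β
      (fun x => b' x / Complex.exp (M x)) (B ∩ V) := fun x hx => by
    by_cases hxA : x ∈ A
    · simp only [hβ, if_pos hxA]
      have h1 := hb0 x ⟨hxA, hx.2⟩
      have h2 := hb0' x hx
      rw [hMq x ⟨hxA, hx.1⟩, hqV ⟨⟨hxA, hx.1⟩, hx.2⟩]
      field_simp
    · exact if_neg hxA
  refine ⟨α, β,
    continuousOn_union_inter hA hB (ha.congr e1A) ((ha'.mul (by fun_prop)).congr e1B),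
    continuousOn_union_inter hA hB (hb.congr e2A)
      ((hb'.div (by fun_prop) fun x _ => Complex.exp_ne_zero _).congr e2B), ?_, ?_, ?_⟩
  · rintro x ⟨hx | hx, hxU⟩
    · rw [e1A ⟨hx, hxU⟩]; exact ha0 x ⟨hx, hxU⟩
    · rw [e1B ⟨hx, hxU⟩]; exact mul_ne_zero (ha0' x ⟨hx, hxU⟩) (Complex.exp_ne_zero _)
  · rintro x ⟨hx | hx, hxV⟩
    · rw [e2A ⟨hx, hxV⟩]; exact hb0 x ⟨hx, hxV⟩
    · rw [e2B ⟨hx, hxV⟩]; exact div_ne_zero (hb0' x ⟨hx, hxV⟩) (Complex.exp_ne_zero _)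
  · rintro x ⟨hx | hx, hxU, hxV⟩
    · rw [e1A ⟨hx, hxU⟩, e2A ⟨hx, hxV⟩]; exact hab x ⟨hx, hxU, hxV⟩
    · rw [e1B ⟨hx, hxU⟩, e2B ⟨hx, hxV⟩, hab' x ⟨hx, hxU, hxV⟩]
      have := Complex.exp_ne_zero (M x)
      field_simp

theorem splitsOn_of_subset {U V : Set X} {c : X → ℂ} (hc : ContinuousOn c (U ∩ V))
    (hc0 : ∀ x ∈ U ∩ V, c x ≠ 0) {A : Set X} (h : A ⊆ U ∨ A ⊆ V) : SplitsOn U V c A := by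
  rcases h with h | h
  · exact ⟨1, c, continuousOn_const, hc.mono fun x hx => ⟨h hx.1, hx.2⟩, fun _ _ => one_ne_zero,
      fun x hx => hc0 x ⟨h hx.1, hx.2⟩, fun x _ => by simp⟩
  · exact ⟨c, 1, hc.mono fun x hx => ⟨hx.2, h hx.1⟩, continuousOn_const,
      fun x hx => hc0 x ⟨hx.2, h hx.1⟩, fun _ _ => one_ne_zero, fun x _ => by simp⟩

theorem SplitsOn.of_retract {Z : Type*} [TopologicalSpace Z] {U V : Set X} {c : X → ℂ}
    {A : Set X} {B : Set Z} (r : C(Z, X)) (i : X → Z) (hi : ContinuousOn i A)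
    (hiB : ∀ x ∈ A, i x ∈ B) (hri : ∀ x ∈ A, r (i x) = x)
    (h : SplitsOn (r ⁻¹' U) (r ⁻¹' V) (fun z => c (r z)) B) : SplitsOn U V c A := by
  obtain ⟨a, b, ha, hb, ha0, hb0, hab⟩ := h
  have hm : ∀ W : Set X, ∀ x ∈ A ∩ W, i x ∈ B ∩ r ⁻¹' W := fun W x hx =>
    ⟨hiB x hx.1, by rw [Set.mem_preimage, hri x hx.1]; exact hx.2⟩
  refine ⟨fun x => a (i x), fun x => b (i x),
    ha.comp (hi.mono Set.inter_subset_left) (hm U), hb.comp (hi.mono Set.inter_subset_left) (hm V),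
    fun x hx => ha0 _ (hm U x hx), fun x hx => hb0 _ (hm V x hx), fun x hx => ?_⟩
  rw [← hab _ (hm _ x hx)]
  simp only [hri x hx.1]

/-- A property of compact intervals that holds for short intervals and is additive holds for all
intervals. -/
theorem interval_additive_induction {R : ℝ → ℝ → Prop} {lo hi δ : ℝ} (hδ : 0 < δ)
    (hsmall : ∀ s t, lo ≤ s → s ≤ t → t ≤ hi → t ≤ s + δ → R s t)
    (hadd : ∀ s m t, lo ≤ s → s ≤ m → m ≤ t → t ≤ hi → R s m → R m t → R s t)
    {s t : ℝ} (hs : lo ≤ s) (hst : s ≤ t) (ht : t ≤ hi) : R s t := by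
  have key : ∀ n : ℕ, ∀ s t, lo ≤ s → s ≤ t → t ≤ hi → t ≤ s + n * δ → R s t := by
    intro n
    induction n with
    | zero =>
      intro s t h1 h2 h3 h4
      exact hsmall s t h1 h2 h3 (by simp at h4; linarith)
    | succ n ih =>
      intro s t h1 h2 h3 h4
      push_cast at h4
      by_cases h5 : t ≤ s + δ
      · exact hsmall s t h1 h2 h3 h5
      · push Not at h5
        exact hadd s (s + δ) t h1 (by linarith) h5.le h3
          (hsmall _ _ h1 (by linarith) (by linarith) le_rfl)
          (ih _ _ (by linarith) h5.le h3 (by linarith))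
  obtain ⟨n, hn⟩ := exists_nat_ge ((t - s) / δ)
  exact key n s t hs hst ht (by rw [div_le_iff₀ hδ] at hn; linarith)

theorem hasLogs_of_convex {E : Type*} [AddCommGroup E] [Module ℝ E] [TopologicalSpace E]
    [ContinuousAdd E] [ContinuousSMul ℝ E] {A : Set E} (hA : Convex ℝ A) : HasLogs A := by
  rcases A.eq_empty_or_nonempty with rfl | hne
  · exact fun f _ _ => ⟨f, by simp, by simp⟩
  · have := hA.contractibleSpace hne
    exact hasLogs_of_contractible

/-- Every nonvanishing function on the intersection of two open sets that cover `ℝ³` splits over a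
cube. -/
theorem splitsOn_cube {U V : Set (ℝ × ℝ × ℝ)} (hU : IsOpen U) (hV : IsOpen V)
    (hUV : U ∪ V = Set.univ) {c : ℝ × ℝ × ℝ → ℂ} (hc : ContinuousOn c (U ∩ V))
    (hc0 : ∀ x ∈ U ∩ V, c x ≠ 0) :
    SplitsOn U V c (Set.Icc (-1) 1 ×ˢ Set.Icc (-1) 1 ×ˢ Set.Icc (-1) 1) := by
  set K : Set (ℝ × ℝ × ℝ) := Set.Icc (-1) 1 ×ˢ Set.Icc (-1) 1 ×ˢ Set.Icc (-1) 1 with hK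
  have hKc : IsCompact K := isCompact_Icc.prod (isCompact_Icc.prod isCompact_Icc)
  -- Boxes with sides at most δ / 2 lie in a ball inside U or V, where the splitting is trivial.
  -- Gluing then proceeds one coordinate at a time; adjacent boxes meet in a convex set, which has
  -- logarithms.
  obtain ⟨δ, hδ, hball⟩ := lebesgue_number_lemma_of_metric (ι := Bool) hKc
    (c := fun i => if i then U else V) (by rintro (_ | _) <;> simpa) (by
      intro x _
      have : x ∈ U ∪ V := hUV ▸ Set.mem_univ x
      rw [Set.mem_iUnion]
      rcases this with h | h
      · exact ⟨true, by simpa⟩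
      · exact ⟨false, by simpa⟩)
  have hδ2 : 0 < δ / 2 := by positivity
  have hI : ∀ s m t : ℝ, s ≤ m → m ≤ t → Set.Icc s t = Set.Icc s m ∪ Set.Icc m t :=
    fun s m t h h' => (Set.Icc_union_Icc_eq_Icc h h').symm
  have hcl : ∀ x x' y y' z z' : ℝ, IsClosed (Set.Icc x x' ×ˢ Set.Icc y y' ×ˢ Set.Icc z z') :=
    fun _ _ _ _ _ _ => isClosed_Icc.prod (isClosed_Icc.prod isClosed_Icc)
  have hconv : ∀ x x' y y' z z' : ℝ,
      Convex ℝ (Set.Icc x x' ×ˢ Set.Icc y y' ×ˢ Set.Icc z z') :=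
    fun _ _ _ _ _ _ => (convex_Icc _ _).prod ((convex_Icc _ _).prod (convex_Icc _ _))
  have h0 : ∀ x x' y y' z z' : ℝ, -1 ≤ x → x ≤ x' → x' ≤ 1 → x' ≤ x + δ / 2 →
      -1 ≤ y → y ≤ y' → y' ≤ 1 → y' ≤ y + δ / 2 → -1 ≤ z → z ≤ z' → z' ≤ 1 → z' ≤ z + δ / 2 →
      SplitsOn U V c (Set.Icc x x' ×ˢ Set.Icc y y' ×ˢ Set.Icc z z') := by
    intro x x' y y' z z' hx hxx hx' hxd hy hyy hy' hyd hz hzz hz' hzd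
    obtain ⟨i, hi⟩ := hball (x, y, z) ⟨⟨hx, by linarith⟩, ⟨hy, by linarith⟩, ⟨hz, by linarith⟩⟩
    have hsub : Set.Icc x x' ×ˢ Set.Icc y y' ×ˢ Set.Icc z z' ⊆ Metric.ball (x, y, z) δ := by
      rintro ⟨u, v, w⟩ ⟨⟨h1, h2⟩, ⟨h3, h4⟩, ⟨h5, h6⟩⟩
      simp only at h1 h2 h3 h4 h5 h6
      simp only [Metric.mem_ball, Prod.dist_eq, Real.dist_eq, sup_lt_iff, abs_lt]
      refine ⟨⟨?_, ?_⟩, ⟨?_, ?_⟩, ?_, ?_⟩ <;> linarith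
    refine splitsOn_of_subset hc hc0 ?_
    rcases i with _ | _
    · exact Or.inr (hsub.trans (by simpa using hi))
    · exact Or.inl (hsub.trans (by simpa using hi))
  have hglue : ∀ {A B : Set (ℝ × ℝ × ℝ)}, IsClosed A → IsClosed B → Convex ℝ A → Convex ℝ B →
      SplitsOn U V c A → SplitsOn U V c B → SplitsOn U V c (A ∪ B) :=
    fun hA hB hA' hB' h h' => h.union hU hV hUV hA hB (hasLogs_of_convex (hA'.inter hB')) h'
  have h1 : ∀ x x' y y' : ℝ, -1 ≤ x → x ≤ x' → x' ≤ 1 → x' ≤ x + δ / 2 →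
      -1 ≤ y → y ≤ y' → y' ≤ 1 → y' ≤ y + δ / 2 →
      SplitsOn U V c (Set.Icc x x' ×ˢ Set.Icc y y' ×ˢ Set.Icc (-1) 1) := by
    intro x x' y y' hx hxx hx' hxd hy hyy hy' hyd
    refine interval_additive_induction
      (R := fun s t => SplitsOn U V c (Set.Icc x x' ×ˢ Set.Icc y y' ×ˢ Set.Icc s t)) hδ2
      (fun s t hs hst ht hd => h0 _ _ _ _ _ _ hx hxx hx' hxd hy hyy hy' hyd hs hst ht hd)
      (fun s m t hs hsm hmt ht h h' => ?_) le_rfl (by norm_num) le_rfl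
    rw [hI s m t hsm hmt, Set.prod_union, Set.prod_union]
    exact hglue (hcl _ _ _ _ _ _) (hcl _ _ _ _ _ _) (hconv _ _ _ _ _ _) (hconv _ _ _ _ _ _) h h'
  have h2 : ∀ x x' : ℝ, -1 ≤ x → x ≤ x' → x' ≤ 1 → x' ≤ x + δ / 2 →
      SplitsOn U V c (Set.Icc x x' ×ˢ Set.Icc (-1) 1 ×ˢ Set.Icc (-1) 1) := by
    intro x x' hx hxx hx' hxd
    refine interval_additive_induction
      (R := fun s t => SplitsOn U V c (Set.Icc x x' ×ˢ Set.Icc s t ×ˢ Set.Icc (-1) 1)) hδ2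
      (fun s t hs hst ht hd => h1 _ _ _ _ hx hxx hx' hxd hs hst ht hd)
      (fun s m t hs hsm hmt ht h h' => ?_) le_rfl (by norm_num) le_rfl
    rw [hI s m t hsm hmt, Set.union_prod, Set.prod_union]
    exact hglue (hcl _ _ _ _ _ _) (hcl _ _ _ _ _ _) (hconv _ _ _ _ _ _) (hconv _ _ _ _ _ _) h h'
  refine interval_additive_induction
    (R := fun s t => SplitsOn U V c (Set.Icc s t ×ˢ Set.Icc (-1) 1 ×ˢ Set.Icc (-1) 1)) hδ2
    (fun s t hs hst ht hd => h2 _ _ hs hst ht hd)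
    (fun s m t hs hsm hmt ht h h' => ?_) le_rfl (by norm_num) le_rfl
  rw [hI s m t hsm hmt, Set.union_prod]
  exact hglue (hcl _ _ _ _ _ _) (hcl _ _ _ _ _ _) (hconv _ _ _ _ _ _) (hconv _ _ _ _ _ _) h h'

end Splitting

/-! ### The three-sphere: H²(S³; ℤ) = 0 -/

section Sphere

theorem threeSphere_norm_sq (x : ThreeSphere) : ‖x.1 0‖ ^ 2 + ‖x.1 1‖ ^ 2 = 1 := by
  have h : ‖x.1‖ = 1 := by simp
  have := EuclideanSpace.norm_sq_eq x.1
  rw [h, Fin.sum_univ_two] at this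
  linarith

@[fun_prop]
theorem continuous_threeSphere_coord (i : Fin 2) : Continuous fun x : ThreeSphere => x.1 i :=
  (EuclideanSpace.proj (𝕜 := ℂ) i).continuous.comp continuous_subtype_val

theorem threeSphere_ext {x y : ThreeSphere} (h0 : x.1 0 = y.1 0) (h1 : x.1 1 = y.1 1) : x = y := by
  ext i
  fin_cases i
  exacts [h0, h1]

/-- The point of the three-sphere in the direction `(a, b)`, depending continuously on a
parameter. -/
noncomputable def sphereMap {Z : Type*} [TopologicalSpace Z] (a b : C(Z, ℂ))
    (h : ∀ z, a z ≠ 0 ∨ b z ≠ 0) : C(Z, ThreeSphere) where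
  toFun z := ⟨‖!₂[a z, b z]‖⁻¹ • !₂[a z, b z], by
    have : !₂[a z, b z] ≠ 0 := fun h0 => by
      rcases h z with h | h
      · exact h (by simpa using congrArg (fun v : EuclideanSpace ℂ (Fin 2) => v 0) h0)
      · exact h (by simpa using congrArg (fun v : EuclideanSpace ℂ (Fin 2) => v 1) h0)
    rw [mem_sphere_zero_iff_norm, norm_smul, norm_inv, norm_norm, inv_mul_cancel₀ (norm_ne_zero_iff.2 this)]⟩
  continuous_toFun := by
    have hc : Continuous fun z => !₂[a z, b z] := by
      refine (PiLp.continuous_toLp 2 _).comp (continuous_pi fun i => ?_)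
      fin_cases i
      exacts [a.continuous, b.continuous]
    refine Continuous.subtype_mk (Continuous.smul (hc.norm.inv₀ fun z h0 => ?_) hc) _
    rw [norm_eq_zero] at h0
    rcases h z with h | h
    · exact h (by simpa using congrArg (fun v : EuclideanSpace ℂ (Fin 2) => v 0) h0)
    · exact h (by simpa using congrArg (fun v : EuclideanSpace ℂ (Fin 2) => v 1) h0)

variable {Z : Type*} [TopologicalSpace Z] (a b : C(Z, ℂ)) (h : ∀ z, a z ≠ 0 ∨ b z ≠ 0)

theorem sphereMap_coord (z : Z) :
    (sphereMap a b h z).1 0 = (√(‖a z‖ ^ 2 + ‖b z‖ ^ 2))⁻¹ * a z ∧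
    (sphereMap a b h z).1 1 = (√(‖a z‖ ^ 2 + ‖b z‖ ^ 2))⁻¹ * b z := by
  have hn : ‖!₂[a z, b z]‖ = √(‖a z‖ ^ 2 + ‖b z‖ ^ 2) := by
    rw [EuclideanSpace.norm_eq]; simp
  constructor
  · change ((‖!₂[a z, b z]‖⁻¹ • !₂[a z, b z] : EuclideanSpace ℂ (Fin 2))) 0 = _
    rw [hn]
    simp
  · change ((‖!₂[a z, b z]‖⁻¹ • !₂[a z, b z] : EuclideanSpace ℂ (Fin 2))) 1 = _
    rw [hn]
    simp

theorem sphereMap_eq {z : Z} {x : ThreeSphere} (ha : a z = x.1 0) (hb : b z = x.1 1) :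
    sphereMap a b h z = x := by
  have h1 := sphereMap_coord a b h z
  rw [ha, hb, threeSphere_norm_sq] at h1
  exact threeSphere_ext (by simpa using h1.1) (by simpa using h1.2)

/-- The hemispheres `0 ≤ ε * Im x₁` for `ε = ±1`. -/
def hemisphere (ε : ℝ) : Set ThreeSphere := {x | 0 ≤ ε * (x.1 1).im}

theorem isClosed_hemisphere (ε : ℝ) : IsClosed (hemisphere ε) :=
  isClosed_le continuous_const (by fun_prop)

/-- Forgetting Im x₁ embeds the hemisphere in the cube, and a map ℝ³ → S³ inverts this embedding, so
the splitting over the cube pulls back. -/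
theorem splitsOn_hemisphere {ε : ℝ} (hε : ε ^ 2 = 1) {U V : Set ThreeSphere} (hU : IsOpen U)
    (hV : IsOpen V) (hUV : U ∪ V = Set.univ) {c : ThreeSphere → ℂ} (hc : ContinuousOn c (U ∩ V))
    (hc0 : ∀ x ∈ U ∩ V, c x ≠ 0) : SplitsOn U V c (hemisphere ε) := by
  set a : C(ℝ × ℝ × ℝ, ℂ) := ⟨fun v => v.1 + v.2.1 * Complex.I, by fun_prop⟩ with ha
  -- Outside the unit ball the square root takes the value 0, so the formula stays continuous on ℝ³;
  -- `sphereMap` normalizes the resulting vector.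
  set b : C(ℝ × ℝ × ℝ, ℂ) := ⟨fun v => v.2.2 +
    (ε * √(1 - v.1 ^ 2 - v.2.1 ^ 2 - v.2.2 ^ 2) : ℝ) * Complex.I, by fun_prop⟩ with hb
  have hab : ∀ v, a v ≠ 0 ∨ b v ≠ 0 := by
    intro v
    by_contra! hcon
    obtain ⟨h1, h2⟩ := hcon
    have e1 : v.1 = 0 := by simpa [ha] using congrArg Complex.re h1
    have e2 : v.2.1 = 0 := by simpa [ha] using congrArg Complex.im h1
    have e3 : v.2.2 = 0 := by simpa [hb] using congrArg Complex.re h2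
    have e4 : ε * √(1 - v.1 ^ 2 - v.2.1 ^ 2 - v.2.2 ^ 2) = 0 := by
      simpa [hb] using congrArg Complex.im h2
    rw [e1, e2, e3] at e4
    have : ε = 0 := by simpa using e4
    rw [this] at hε
    norm_num at hε
  set r := sphereMap a b hab with hr
  set i : ThreeSphere → ℝ × ℝ × ℝ := fun x => ((x.1 0).re, (x.1 0).im, (x.1 1).re) with hi
  have hnorm : ∀ x : ThreeSphere,
      (x.1 0).re ^ 2 + (x.1 0).im ^ 2 + (x.1 1).re ^ 2 + (x.1 1).im ^ 2 = 1 := fun x => by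
    have := threeSphere_norm_sq x
    rw [Complex.sq_norm, Complex.sq_norm, Complex.normSq_apply, Complex.normSq_apply] at this
    linarith
  refine SplitsOn.of_retract (B := Set.Icc (-1) 1 ×ˢ Set.Icc (-1) 1 ×ˢ Set.Icc (-1) 1) r i
    (Continuous.continuousOn (by fun_prop)) (fun x _ => ?_) (fun x hx => ?_)
    (splitsOn_cube (hU.preimage r.continuous) (hV.preimage r.continuous)
      (by rw [← Set.preimage_union, hUV, Set.preimage_univ])
      (hc.comp r.continuous.continuousOn fun z hz => hz) fun z hz => hc0 _ hz)
  · have := hnorm x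
    have h1 : |(x.1 0).re| ≤ 1 := abs_le_one_iff_mul_self_le_one.2 (by nlinarith)
    have h2 : |(x.1 0).im| ≤ 1 := abs_le_one_iff_mul_self_le_one.2 (by nlinarith)
    have h3 : |(x.1 1).re| ≤ 1 := abs_le_one_iff_mul_self_le_one.2 (by nlinarith)
    exact ⟨abs_le.1 h1, abs_le.1 h2, abs_le.1 h3⟩
  · refine sphereMap_eq _ _ _ (Complex.ext (by simp [ha, hi]) (by simp [ha, hi])) ?_
    have h1 : 1 - (x.1 0).re ^ 2 - (x.1 0).im ^ 2 - (x.1 1).re ^ 2 = (ε * (x.1 1).im) ^ 2 := by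
      rw [mul_pow, hε]
      linarith [hnorm x]
    have h2 : ε * √(1 - (x.1 0).re ^ 2 - (x.1 0).im ^ 2 - (x.1 1).re ^ 2) = (x.1 1).im := by
      rw [h1, Real.sqrt_sq hx, ← mul_assoc, ← sq, hε, one_mul]
    refine Complex.ext (by simp [hb, hi]) ?_
    simp only [hb, hi, ContinuousMap.coe_mk, h2]
    simp

/-- The half-spheres `Im x₁ = 0 ≤ ε * Re x₁` for `ε = ±1`. -/
def halfTwoSphere (ε : ℝ) : Set ThreeSphere := {x | (x.1 1).im = 0 ∧ 0 ≤ ε * (x.1 1).re}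

theorem hasLogs_halfTwoSphere {ε : ℝ} (hε : ε ^ 2 = 1) : HasLogs (halfTwoSphere ε) := by
  set a : C(ℝ × ℝ, ℂ) := ⟨fun v => v.1 + v.2 * Complex.I, by fun_prop⟩ with ha
  set b : C(ℝ × ℝ, ℂ) := ⟨fun v => (ε * √(1 - v.1 ^ 2 - v.2 ^ 2) : ℝ), by fun_prop⟩ with hb
  have hab : ∀ v, a v ≠ 0 ∨ b v ≠ 0 := by
    intro v
    by_contra! hcon
    obtain ⟨h1, h2⟩ := hcon
    have e1 : v.1 = 0 := by simpa [ha] using congrArg Complex.re h1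
    have e2 : v.2 = 0 := by simpa [ha] using congrArg Complex.im h1
    have e4 : ε * √(1 - v.1 ^ 2 - v.2 ^ 2) = 0 := Complex.ofReal_eq_zero.1 h2
    rw [e1, e2] at e4
    have : ε = 0 := by simpa using e4
    rw [this] at hε
    norm_num at hε
  refine hasLogs_of_retract (sphereMap a b hab) (fun z => ?_)
    (fun x => ((x.1 0).re, (x.1 0).im)) (Continuous.continuousOn (by fun_prop)) (fun x hx => ?_)
  · have h1 := (sphereMap_coord a b hab z).2
    rw [show b z = ((ε * √(1 - z.1 ^ 2 - z.2 ^ 2) : ℝ) : ℂ) from rfl,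
      ← Complex.ofReal_mul] at h1
    constructor
    · rw [h1, Complex.ofReal_im]
    · rw [h1, Complex.ofReal_re]
      have : ∀ N s : ℝ, ε * (N * (ε * s)) = ε ^ 2 * (N * s) := fun N s => by ring
      rw [this, hε]
      positivity
  · refine sphereMap_eq _ _ _ (Complex.ext (by simp [ha]) (by simp [ha])) ?_
    have := threeSphere_norm_sq x
    rw [Complex.sq_norm, Complex.sq_norm, Complex.normSq_apply, Complex.normSq_apply, hx.1] at this
    have h1 : 1 - (x.1 0).re ^ 2 - (x.1 0).im ^ 2 = (ε * (x.1 1).re) ^ 2 := by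
      rw [mul_pow, hε]
      linarith
    have h2 : ε * √(1 - (x.1 0).re ^ 2 - (x.1 0).im ^ 2) = (x.1 1).re := by
      rw [h1, Real.sqrt_sq hx.2, ← mul_assoc, ← sq, hε, one_mul]
    simp only [hb, ContinuousMap.coe_mk, h2]
    exact Complex.ext (by simp) (by simp [hx.1])

/-- The 2-sphere is a union of two discs that meet in the connected circle x₁ = 0. -/
theorem hasLogs_equatorial_twoSphere : HasLogs {x : ThreeSphere | (x.1 1).im = 0} := by
  have hcl : ∀ ε, IsClosed (halfTwoSphere ε) := fun ε =>
    IsClosed.inter (isClosed_eq (f := fun x : ThreeSphere => (x.1 1).im) (by fun_prop)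
      continuous_const) (isClosed_le (g := fun x : ThreeSphere => ε * (x.1 1).re) continuous_const
      (by fun_prop))
  have hinter : halfTwoSphere 1 ∩ halfTwoSphere (-1) = {x : ThreeSphere | x.1 1 = 0} := by
    ext x
    constructor
    · rintro ⟨⟨h1, h2⟩, -, h3⟩
      refine Complex.ext ?_ h1
      simp only [Complex.zero_re]
      linarith
    · intro h
      simp only [Set.mem_ofPred_eq] at h
      simp [halfTwoSphere, h]
  have hpre : IsPreconnected {x : ThreeSphere | x.1 1 = 0} := by
    set a : C(ℝ, ℂ) := ⟨fun t => Complex.exp (t * Complex.I), by fun_prop⟩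
    have hab : ∀ t, a t ≠ 0 ∨ (0 : C(ℝ, ℂ)) t ≠ 0 := fun t => Or.inl (Complex.exp_ne_zero _)
    have : {x : ThreeSphere | x.1 1 = 0} = Set.range (sphereMap a 0 hab) := by
      ext x
      constructor
      · intro hx
        simp only [Set.mem_ofPred_eq] at hx
        have := threeSphere_norm_sq x
        rw [hx] at this
        have h1 : ‖x.1 0‖ = 1 := by
          have : ‖x.1 0‖ ^ 2 = 1 := by simpa using this
          exact (pow_eq_one_iff_of_nonneg (norm_nonneg _) two_ne_zero).1 this
        refine ⟨Complex.arg (x.1 0), sphereMap_eq _ _ _ ?_ (by simp [hx])⟩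
        have := Complex.norm_mul_exp_arg_mul_I (x.1 0)
        rw [h1] at this
        simpa [a] using this
      · rintro ⟨t, rfl⟩
        have := (sphereMap_coord a 0 hab t).2
        simpa using this
    rw [this]
    exact isPreconnected_range (map_continuous _)
  have : {x : ThreeSphere | (x.1 1).im = 0} = halfTwoSphere 1 ∪ halfTwoSphere (-1) := by
    ext x
    simp only [halfTwoSphere, Set.mem_ofPred_eq, Set.mem_union, ← and_or_left]
    exact ⟨fun h => ⟨h, by rcases le_total 0 (x.1 1).re with h' | h' <;> [left; right] <;> linarith⟩,
      fun h => h.1⟩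
  rw [this]
  exact HasLogs.union (hcl 1) (hcl (-1)) (hinter ▸ hpre) (hasLogs_halfTwoSphere (by norm_num))
    (hasLogs_halfTwoSphere (by norm_num))

/-- Every nonvanishing function on the intersection of two open sets that cover `S³` is a product
of nonvanishing functions on these sets: `H²(S³; ℤ) = 0`. -/
theorem splitsOn_threeSphere {U V : Set ThreeSphere} (hU : IsOpen U)
    (hV : IsOpen V) (hUV : U ∪ V = Set.univ) {c : ThreeSphere → ℂ} (hc : ContinuousOn c (U ∩ V))
    (hc0 : ∀ x ∈ U ∩ V, c x ≠ 0) : SplitsOn U V c Set.univ := by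
  have hunion : hemisphere 1 ∪ hemisphere (-1) = Set.univ := by
    ext x
    simp only [hemisphere, Set.mem_union, Set.mem_ofPred_eq, Set.mem_univ, iff_true]
    rcases le_total 0 (x.1 1).im with h' | h' <;> [left; right] <;> linarith
  have hinter : hemisphere 1 ∩ hemisphere (-1) = {x : ThreeSphere | (x.1 1).im = 0} := by
    ext x
    simp only [hemisphere, Set.mem_inter_iff, Set.mem_ofPred_eq]
    exact ⟨fun h => by linarith [h.1, h.2], fun h => by simp [h]⟩
  rw [← hunion]
  exact SplitsOn.union hU hV hUV (isClosed_hemisphere _) (isClosed_hemisphere _)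
    (hinter ▸ hasLogs_equatorial_twoSphere)
    (splitsOn_hemisphere (by norm_num) hU hV hUV hc hc0)
    (splitsOn_hemisphere (by norm_num) hU hV hUV hc hc0)

end Sphere

/-! ### A nonvanishing extension of the normal coordinate -/

section LinkingFunction

open unitInterval

namespace TubularNeighborhood

variable {C : Set ThreeSphere}

theorem isClosed_core (T : TubularNeighborhood C) : IsClosed C := by
  rw [← T.core_eq]
  have : Continuous fun z : Circle => T.toFun (z, 0) :=
    T.isOpenEmbedding.continuous.comp (by fun_prop)
  exact (isCompact_range this).isClosed

/-- A nonvanishing function on the complement of `C` that agrees on the tubular neighbourhood with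
the normal coordinate, up to a nonvanishing factor. -/
theorem exists_complement_function (T : TubularNeighborhood C) :
    ∃ (e : ThreeSphere → ℂ) (ν : C(Circle × ℂ, ℂ)), ContinuousOn e Cᶜ ∧ (∀ x ∈ Cᶜ, e x ≠ 0) ∧
      (∀ q, ν q ≠ 0) ∧ ∀ z w, w ≠ 0 → e (T.toFun (z, w)) = w * ν (z, w) := by
  set φ := T.isOpenEmbedding.toOpenPartialHomeomorph T.toFun with hφ
  have hsymm : ∀ q, φ.symm (T.toFun q) = q := fun q =>
    φ.left_inv (by simp [hφ])
  have hc : ContinuousOn (fun x => (φ.symm x).2) (Set.range T.toFun ∩ Cᶜ) := by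
    refine continuous_snd.comp_continuousOn (φ.continuousOn_symm.mono ?_)
    simp [hφ]
  have hcover : Set.range T.toFun ∪ Cᶜ = Set.univ := by
    refine Set.eq_univ_of_forall fun x => ?_
    by_cases hx : x ∈ C
    · obtain ⟨z, rfl⟩ := T.core_eq.symm.subset hx
      exact Or.inl ⟨_, rfl⟩
    · exact Or.inr hx
  have hc0 : ∀ x ∈ Set.range T.toFun ∩ Cᶜ, (φ.symm x).2 ≠ 0 := by
    rintro _ ⟨⟨⟨z, w⟩, rfl⟩, hx⟩ h0
    rw [hsymm] at h0
    simp only at h0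
    subst h0
    exact hx (T.core_eq.subset ⟨z, rfl⟩)
  -- The normal coordinate, nonvanishing on the overlap of the tube and the complement of C, is
  -- split as a · b; then b is the required function and 1 / a the correction factor on the tube.
  obtain ⟨a, b, ha, hb, ha0, hb0, hab⟩ := splitsOn_threeSphere T.isOpenEmbedding.isOpen_range
    T.isClosed_core.isOpen_compl hcover hc hc0
  simp only [Set.univ_inter] at ha hb ha0 hb0 hab
  have hTa : Continuous fun q => a (T.toFun q) :=
    ha.comp_continuous T.isOpenEmbedding.continuous fun q => ⟨q, rfl⟩
  have ha0' : ∀ q, a (T.toFun q) ≠ 0 := fun q => ha0 _ ⟨q, rfl⟩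
  refine ⟨b, ⟨fun q => (a (T.toFun q))⁻¹, hTa.inv₀ ha0'⟩, hb, hb0, fun q => inv_ne_zero (ha0' q),
    fun z w hw => ?_⟩
  have h1 := hab _ ⟨⟨(z, w), rfl⟩, T.apply_notMem z hw⟩
  rw [hsymm] at h1
  simp only at h1
  simp only [ContinuousMap.coe_mk]
  have := ha0' (z, w)
  rw [eq_mul_inv_iff_mul_eq₀ this, mul_comm]
  exact h1.symm

end TubularNeighborhood

/-- A nonvanishing function has a logarithm along every null-homologous closed curve. -/
theorem IsNullHomologous.exists_log {X : Type*} [TopologicalSpace X] {f : C(Circle, X)}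
    (hf : IsNullHomologous f) (F : C(X, ℂ)) (hF : ∀ x, F x ≠ 0) :
    ∃ L : Path (0 : ℂ) 0, ∀ t : I, Complex.exp (L t) = F (circleLoop f t) / F (f 1) := by
  set F' : C(X, ℂ) := ⟨fun x => F x / F (f 1), by fun_prop⟩ with hF'
  have hF'0 : ∀ x, F' x ≠ 0 := fun x => div_ne_zero (hF x) (hF _)
  have hF'1 : F' (f 1) = 1 := div_self (hF _)
  -- Only the degree is needed here, so the second function is trivial.
  set H : C({q : X × ℂ // Complex.exp q.2 = F' q.1}, ℂ) := ContinuousMap.const _ 1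
  have hH : ∀ q, H q ≠ 0 := fun q => one_ne_zero
  obtain ⟨c, hc⟩ := exists_degreeCocycle hF'0 hH (f 1) hF'1
  obtain ⟨τ, r, h⟩ := exists_liftsTo hF'0 hH (circleLoop f) 0 (by rw [hF'1, Complex.exp_zero])
  obtain ⟨m, hm⟩ := Complex.exp_eq_one_iff.1 (h.exp_right.trans hF'1)
  have h1 := (hc (circleLoop f) 0 m r (by rw [← hm]; simpa using h)).1
  rw [c.d_eq_zero_of_mem_commutator hf] at h1
  have hm0 : m = 0 := by omega
  have hτ : τ = 0 := by rw [hm, hm0]; simp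
  subst hτ
  obtain ⟨-, -, L, -, hL, -⟩ := h
  exact ⟨L, hL⟩

/-- A nonvanishing function on `S¹ × ℂ` has a logarithm if it has one along `S¹ × {1}`. -/
theorem exists_log_solidTorus (ν : C(Circle × ℂ, ℂ)) (hν : ∀ q, ν q ≠ 0) (L : Path (0 : ℂ) 0)
    (hL : ∀ t : I, Complex.exp (L t) = ν (Circle.exp (2 * Real.pi * (t : ℝ)), 1) / ν (1, 1)) :
    ∃ η : C(Circle × ℂ, ℂ), ∀ q, Complex.exp (η q) = ν q := by
  obtain ⟨M, hM⟩ := exists_log_of_contractible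
    (⟨fun q => ν (Circle.exp q.1, q.2), by fun_prop⟩ : C(ℝ × ℂ, ℂ)) (fun q => hν _)
  simp only [ContinuousMap.coe_mk] at hM
  have h1 : (fun t : I => M (2 * Real.pi * (t : ℝ), 1) - M (0, 1)) = L :=
    log_unique (by fun_prop) L.continuous
      (fun t => by rw [hL, Complex.exp_sub, hM, hM]; simp) 0 (by simp)
  have h2 : M (2 * Real.pi, 1) = M (0, 1) := by
    have := congrFun h1 1
    simp only [Path.target, Set.Icc.coe_one, mul_one] at this
    exact sub_eq_zero.1 this
  -- Translation by 2π changes the logarithm by a constant, which vanishes at (0, 1).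
  have hper : ∀ w, Function.Periodic (fun t => M (t, w)) (2 * Real.pi) := fun w t => by
    have := log_sub_log_eq (L := fun q : ℝ × ℂ => M (q.1 + 2 * Real.pi, q.2)) (L' := M)
      (by fun_prop) M.continuous (fun q => by rw [hM, hM]; simp) (t, w) (0, 1)
    simp only [zero_add, h2, sub_self] at this
    exact sub_eq_zero.1 this
  have hq : IsOpenQuotientMap (Prod.map (⇑Circle.exp) (id : ℂ → ℂ)) :=
    Circle.isAddQuotientCoveringMap_exp.isOpenQuotientMap.prodMap .id
  -- `Complex.arg` jumps, but periodicity of `M` hides the jump; continuity is checked after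
  -- composing with the quotient map.
  have hη : (fun q : Circle × ℂ => M (Complex.arg q.1, q.2)) ∘ Prod.map (⇑Circle.exp) id = M := by
    ext ⟨t, w⟩
    obtain ⟨m, hm⟩ := Circle.exp_eq_exp.1 (Circle.exp_arg (Circle.exp t))
    simp only [Function.comp_apply, Prod.map_apply, id_eq]
    rw [hm]
    exact (hper w).int_mul m t
  refine ⟨⟨fun q => M (Complex.arg q.1, q.2), ?_⟩, fun q => ?_⟩
  · rw [hq.isQuotientMap.continuous_iff, hη]
    exact M.continuous
  · simp only [ContinuousMap.coe_mk, hM, Circle.exp_arg]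

/-- If the trivialization is the preferred one, then the normal coordinate extends, up to an
exponential factor, to a nonvanishing function on the complement of the knot. -/
theorem TubularNeighborhood.IsPreferred.exists_linking_function {C : Set ThreeSphere}
    {T : TubularNeighborhood C} (hT : T.IsPreferred) :
    ∃ (e : ThreeSphere → ℂ) (η : C(Circle × ℂ, ℂ)), ContinuousOn e Cᶜ ∧ (∀ x ∈ Cᶜ, e x ≠ 0) ∧
      ∀ z w, w ≠ 0 → e (T.toFun (z, w)) = w * Complex.exp (η (z, w)) := by
  obtain ⟨e, ν, he, he0, hν, heν⟩ := T.exists_complement_function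
  obtain ⟨L, hL⟩ := IsNullHomologous.exists_log hT
    ⟨fun x => e x.1, he.comp_continuous continuous_subtype_val fun x => x.2⟩ fun x => he0 _ x.2
  obtain ⟨η, hη⟩ := exists_log_solidTorus ν hν L fun t => by
    rw [hL]
    have : ∀ z, e (T.longitude z).1 = ν (z, 1) := fun z => by
      rw [← one_mul (ν (z, 1)), ← heν z 1 one_ne_zero]; rfl
    simp only [ContinuousMap.coe_mk, this]
    rw [← this, ← this]
    rfl
  exact ⟨e, η, he, he0, fun z w hw => by rw [heν z w hw, hη]⟩

end LinkingFunction

/-! ### A circle-winding function on the Milnor fibre -/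

section MilnorFiber

open Filter Topology

/-- Whether a continuous function is the principal branch of a root is locally constant. -/
theorem eventually_eq_principal_root_iff {Z : Type*} [TopologicalSpace Z] {n : ℕ} (hn : n ≠ 0)
    {f g : Z → ℂ} {z₀ : Z} (hf : ContinuousAt f z₀) (hg : ContinuousAt g z₀)
    (hfg : ∀ z, f z ^ n = g z) (h₀ : 0 < (g z₀).re) :
    ∀ᶠ z in 𝓝 z₀, (f z = g z ^ (n : ℂ)⁻¹ ↔ f z₀ = g z₀ ^ (n : ℂ)⁻¹) := by
  have hslit : g z₀ ∈ Complex.slitPlane := Or.inl h₀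
  have hne : ∀ᶠ z in 𝓝 z₀, g z ≠ 0 :=
    hg.eventually_ne (Complex.slitPlane_ne_zero hslit)
  set κ : Z → ℂ := fun z => f z / g z ^ (n : ℂ)⁻¹ with hκ
  have hroot : ∀ z, (g z ^ (n : ℂ)⁻¹) ^ n = g z := fun z => Complex.cpow_nat_inv_pow _ hn
  have hr0 : ∀ z, g z ≠ 0 → g z ^ (n : ℂ)⁻¹ ≠ 0 := fun z hz h => by
    have := hroot z
    rw [h, zero_pow hn] at this
    exact hz this.symm
  have hκc : ContinuousAt κ z₀ :=
    hf.div (hg.cpow continuousAt_const hslit) (hr0 _ (Complex.slitPlane_ne_zero hslit))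
  have hκn : ∀ z, g z ≠ 0 → κ z ^ n = 1 := fun z hz => by
    rw [hκ, div_pow, hroot, hfg, div_self hz]
  -- The ratio κ to the principal root is a root of unity, and these form a finite set, so κ is
  -- locally constant.
  have hfin : ({w : ℂ | w ^ n = 1} \ {κ z₀}).Finite := by
    refine Set.Finite.subset (Polynomial.nthRoots n (1 : ℂ)).toFinset.finite_toSet fun w hw => ?_
    simpa [Polynomial.mem_nthRoots (Nat.pos_of_ne_zero hn)] using hw.1
  have hev : ∀ᶠ z in 𝓝 z₀, κ z ∉ ({w : ℂ | w ^ n = 1} \ {κ z₀}) :=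
    hκc.eventually (hfin.isClosed.isOpen_compl.mem_nhds (by simp))
  filter_upwards [hne, hev] with z hz hz'
  have h1 : κ z = κ z₀ := by
    by_contra h
    exact hz' ⟨hκn z hz, h⟩
  have h2 : ∀ z, g z ≠ 0 → (f z = g z ^ (n : ℂ)⁻¹ ↔ κ z = 1) := fun z hz =>
    (div_eq_one_iff_eq (hr0 z hz)).symm
  rw [h2 z hz, h2 z₀ (Complex.slitPlane_ne_zero hslit), h1]

/-- The function that is `0` for `x ≤ 1 / 3` and `1` for `2 / 3 ≤ x`, and affine in between. -/
noncomputable def ramp (x : ℝ) : ℝ := max 0 (min 1 (3 * x - 1))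

@[fun_prop]
theorem continuous_ramp : Continuous ramp := by unfold ramp; fun_prop

theorem ramp_of_le {x : ℝ} (hx : x ≤ 1 / 3) : ramp x = 0 :=
  max_eq_left ((min_le_right _ _).trans (by linarith))

theorem ramp_of_ge {x : ℝ} (hx : 2 / 3 ≤ x) : ramp x = 1 := by
  rw [ramp, min_eq_left (by linarith), max_eq_right zero_le_one]

open Classical in
/-- The function on the Milnor fibre `a ^ Q - b ^ P = 1` that winds once across one of the `P * Q`
components of the preimage of the strip `1 / 3 ≤ Re a ^ Q ≤ 2 / 3`, and is `1` elsewhere. -/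
noncomputable def stripFunction (P Q : ℕ) (ε : ℂ) (s : ℂ × ℂ) : ℂ :=
  if s.1 = (s.1 ^ Q) ^ (Q : ℂ)⁻¹ ∧ s.2 / ε = (1 - s.1 ^ Q) ^ (P : ℂ)⁻¹ then
    Complex.exp (2 * Real.pi * Complex.I * ramp (s.1 ^ Q).re) else 1

variable {P Q : ℕ} {ε : ℂ}

theorem stripFunction_ne_zero (s : ℂ × ℂ) : stripFunction P Q ε s ≠ 0 := by
  unfold stripFunction
  split_ifs
  exacts [Complex.exp_ne_zero _, one_ne_zero]

theorem stripFunction_of_le {s : ℂ × ℂ} (hs : (s.1 ^ Q).re ≤ 1 / 3) :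
    stripFunction P Q ε s = 1 := by
  unfold stripFunction
  split_ifs
  · rw [ramp_of_le hs]; simp
  · rfl

theorem stripFunction_of_ge {s : ℂ × ℂ} (hs : 2 / 3 ≤ (s.1 ^ Q).re) :
    stripFunction P Q ε s = 1 := by
  unfold stripFunction
  split_ifs
  · rw [ramp_of_ge hs]; simp [Complex.exp_two_pi_mul_I]
  · rfl

/-- Off the closed strip the function is locally 1. In the strip both a^Q and 1 - a^Q = (b / ε)^P
have positive real part, so the choice of principal roots is locally constant. -/
theorem continuous_stripFunction (hP : P ≠ 0) (hQ : Q ≠ 0) (hε : ε ^ P = -1)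
    {Z : Type*} [TopologicalSpace Z] {f : Z → ℂ × ℂ} (hf : Continuous f)
    (hfib : ∀ z, (f z).1 ^ Q - (f z).2 ^ P = 1) : Continuous fun z => stripFunction P Q ε (f z) := by
  rw [continuous_iff_continuousAt]
  intro z₀
  have hre : Continuous fun z => ((f z).1 ^ Q).re := by fun_prop
  rcases lt_or_ge ((f z₀).1 ^ Q).re (1 / 3) with h | h
  · refine continuousAt_const.congr (f := fun _ => (1 : ℂ)) ?_
    filter_upwards [hre.continuousAt.eventually_lt continuousAt_const h] with z hz
    exact (stripFunction_of_le hz.le).symm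
  rcases lt_or_ge (2 / 3) ((f z₀).1 ^ Q).re with h' | h'
  · refine continuousAt_const.congr (f := fun _ => (1 : ℂ)) ?_
    filter_upwards [continuousAt_const.eventually_lt hre.continuousAt h'] with z hz
    exact (stripFunction_of_ge hz.le).symm
  have h1 := eventually_eq_principal_root_iff hQ (f := fun z => (f z).1)
    (g := fun z => (f z).1 ^ Q) (z₀ := z₀) (by fun_prop) (by fun_prop) (fun z => rfl)
    (by linarith)
  have h2 := eventually_eq_principal_root_iff hP (f := fun z => (f z).2 / ε)
    (g := fun z => 1 - (f z).1 ^ Q) (z₀ := z₀) (by fun_prop) (by fun_prop)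
    (fun z => by rw [div_pow, hε]; linear_combination hfib z)
    (by simp only [Complex.sub_re, Complex.one_re]; linarith)
  by_cases hc : (f z₀).1 = ((f z₀).1 ^ Q) ^ (Q : ℂ)⁻¹ ∧
      (f z₀).2 / ε = (1 - (f z₀).1 ^ Q) ^ (P : ℂ)⁻¹
  · refine ContinuousAt.congr (f := fun z =>
      Complex.exp (2 * Real.pi * Complex.I * ramp ((f z).1 ^ Q).re)) (by fun_prop) ?_
    filter_upwards [h1, h2] with z hz1 hz2
    exact (if_pos ⟨hz1.2 hc.1, hz2.2 hc.2⟩).symm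
  · refine continuousAt_const.congr (f := fun _ => (1 : ℂ)) ?_
    filter_upwards [h1, h2] with z hz1 hz2
    exact (if_neg fun h => hc ⟨hz1.1 h.1, hz2.1 h.2⟩).symm

end MilnorFiber

/-! ### Monodromy along the core, the arc and the meridian -/

section Monodromy

open unitInterval

variable {X : Type*} [TopologicalSpace X] {P Q : ℕ} {ε : ℂ}

/-- The function `u ^ Q - v ^ P`. -/
noncomputable def brieskorn (P Q : ℕ) (u v : C(X, ℂ)) : C(X, ℂ) := u ^ Q - v ^ P

theorem brieskorn_apply (u v : C(X, ℂ)) (x : X) : brieskorn P Q u v x = u x ^ Q - v x ^ P := rfl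

theorem exp_neg_div_pow {n : ℕ} (hn : n ≠ 0) (τ : ℂ) :
    Complex.exp (-τ / n) ^ n = (Complex.exp τ)⁻¹ := by
  rw [← Complex.exp_nat_mul, mul_div_cancel₀ _ (Nat.cast_ne_zero.2 hn), Complex.exp_neg]

/-- The strip function at the point of the Milnor fibre given by `(u, v)` and a logarithm of
`u ^ Q - v ^ P`. -/
noncomputable def stripMap (hP : P ≠ 0) (hQ : Q ≠ 0) (hε : ε ^ P = -1) (u v : C(X, ℂ)) :
    C({q : X × ℂ // Complex.exp q.2 = brieskorn P Q u v q.1}, ℂ) where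
  toFun q := stripFunction P Q ε
    (u q.1.1 * Complex.exp (-q.1.2 / Q), v q.1.1 * Complex.exp (-q.1.2 / P))
  continuous_toFun := by
    refine continuous_stripFunction hP hQ hε (by fun_prop) fun q => ?_
    simp only [mul_pow, exp_neg_div_pow hP, exp_neg_div_pow hQ]
    rw [← sub_mul, ← brieskorn_apply, ← q.2, mul_inv_cancel₀ (Complex.exp_ne_zero _)]

theorem fiber_coord_pow (hQ : Q ≠ 0) (u τ : ℂ) :
    (u * Complex.exp (-τ / Q)) ^ Q = u ^ Q * (Complex.exp τ)⁻¹ := by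
  rw [mul_pow, exp_neg_div_pow hQ]

theorem ofReal_pow_cpow_inv {x : ℝ} (hx : 0 ≤ x) {n : ℕ} (hn : n ≠ 0) :
    ((x : ℂ) ^ n) ^ (n : ℂ)⁻¹ = x := by
  have := Real.pow_rpow_inv_natCast hx hn
  rw [← Complex.ofReal_pow, ← Complex.ofReal_natCast, ← Complex.ofReal_inv,
    ← Complex.ofReal_cpow (by positivity), this]

theorem exp_neg_two_pi_mul_div_eq_one_iff {n : ℤ} {m : ℕ} (hm : m ≠ 0) :
    Complex.exp (-(n * (2 * Real.pi * Complex.I)) / m) = 1 ↔ (m : ℤ) ∣ n := by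
  have h0 := Complex.two_pi_I_ne_zero
  have hm' : (m : ℂ) ≠ 0 := Nat.cast_ne_zero.2 hm
  rw [Complex.exp_eq_one_iff]
  constructor
  · rintro ⟨k, hk⟩
    refine ⟨-k, ?_⟩
    rw [div_eq_iff hm', ← neg_mul] at hk
    have h1 : (2 * Real.pi * Complex.I) * ((-n : ℤ) : ℂ) =
        (2 * Real.pi * Complex.I) * ((k * m : ℤ) : ℂ) := by
      push_cast
      linear_combination hk
    have h2 := Int.cast_injective (mul_left_cancel₀ h0 h1)
    linarith
  · rintro ⟨k, rfl⟩
    refine ⟨-k, ?_⟩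
    push_cast
    field_simp

variable (hP : P ≠ 0) (hQ : Q ≠ 0) (hε : ε ^ P = -1) {u v : C(X, ℂ)}

/-- Monodromy along a loop on which `v = 0` and `u` winds once. -/
theorem liftsTo_core {x : X} (γ : Path x x)
    (hu : ∀ t : I, u (γ t) = Complex.exp (2 * Real.pi * Complex.I * (t : ℝ)))
    (hv : ∀ t, v (γ t) = 0) (n : ℤ) :
    LiftsTo (brieskorn P Q u v) (stripMap hP hQ hε u v) γ (n * (2 * Real.pi * Complex.I))
      ((n + Q : ℤ) * (2 * Real.pi * Complex.I)) 0 := by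
  let L : Path (n * (2 * Real.pi * Complex.I)) ((n + Q : ℤ) * (2 * Real.pi * Complex.I)) :=
    ⟨⟨fun t => (n + Q * (t : ℝ)) * (2 * Real.pi * Complex.I), by fun_prop⟩, by simp, by simp⟩
  have hLt : ∀ t, L t = (n + Q * (t : ℝ)) * (2 * Real.pi * Complex.I) := fun t => rfl
  have hexp : ∀ t, Complex.exp (L t) = u (γ t) ^ Q := fun t => by
    rw [hLt, add_mul, Complex.exp_add, Complex.exp_int_mul_two_pi_mul_I, hu, ← Complex.exp_nat_mul,
      one_mul]
    congr 1
    ring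
  refine ⟨0, 0, L, Path.refl 0, fun t => ?_, fun t => ?_, by simp⟩
  · rw [hexp, brieskorn_apply, hv, zero_pow hP, sub_zero]
  -- With v = 0 the first fibre coordinate satisfies a^Q = 1, beyond the strip.
  · refine (Complex.exp_zero.trans (stripFunction_of_ge ?_).symm)
    simp only
    rw [fiber_coord_pow hQ, hexp, mul_inv_cancel₀ (pow_ne_zero _ _)]
    · norm_num
    · rw [hu]; exact Complex.exp_ne_zero _

/-- Monodromy along a path on which `u = 1` and `v` runs from `0` to `2 * ε`. -/
theorem liftsTo_arc (hco : Nat.Coprime P Q) {x y : X} (γ : Path x y)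
    (hu : ∀ t, u (γ t) = 1) (hv : ∀ t : I, v (γ t) = 2 * (t : ℝ) * ε) (hP2 : 2 ≤ P) (n : ℤ) :
    LiftsTo (brieskorn P Q u v) (stripMap hP hQ hε u v) γ (n * (2 * Real.pi * Complex.I))
      (n * (2 * Real.pi * Complex.I) + Complex.log (1 + 2 ^ P))
      (if ((P * Q : ℕ) : ℤ) ∣ n then -(2 * Real.pi * Complex.I) else 0) := by
  have hε0 : ε ≠ 0 := fun h => by rw [h, zero_pow hP] at hε; norm_num at hε
  -- Since ε^P = -1, this is the value of u^Q - v^P along the path; it is real and at least 1.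
  set s : I → ℝ := fun t => 1 + (2 * (t : ℝ)) ^ P with hs
  have ht0 : ∀ t : I, (0 : ℝ) ≤ t := fun t => t.2.1
  have hs1 : ∀ t, 1 ≤ s t := fun t => by have := ht0 t; simp only [hs]; linarith [show 0 ≤ (2 * (t : ℝ)) ^ P by positivity]
  have hs0 : ∀ t, 0 < s t := fun t => by linarith [hs1 t]
  have hsc : Continuous s := by fun_prop
  have hsC : s 1 = 1 + 2 ^ P := by simp [hs]
  let L : Path (n * (2 * Real.pi * Complex.I))
      (n * (2 * Real.pi * Complex.I) + Complex.log (1 + 2 ^ P)) :=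
    ⟨⟨fun t => n * (2 * Real.pi * Complex.I) + (Real.log (s t) : ℝ),
      by
        have : Continuous fun t => Real.log (s t) := hsc.log fun t => (hs0 t).ne'
        fun_prop⟩, by simp [hs, zero_pow hP], by
      simp only [hsC]
      rw [Complex.ofReal_log (by positivity)]
      push_cast
      rfl⟩
  have hLt : ∀ t, L t = n * (2 * Real.pi * Complex.I) + (Real.log (s t) : ℝ) := fun t => rfl
  have hexp : ∀ t, Complex.exp (L t) = s t := fun t => by
    rw [hLt, Complex.exp_add, Complex.exp_int_mul_two_pi_mul_I, one_mul, ← Complex.ofReal_exp,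
      Real.exp_log (hs0 t)]
  have hbr : ∀ t, brieskorn P Q u v (γ t) = s t := fun t => by
    rw [brieskorn_apply, hu, hv, mul_pow, hε, one_pow]
    simp only [hs]
    push_cast
    ring
  have hsplit : ∀ (t : I) (m : ℕ), Complex.exp (-L t / m) =
      Complex.exp (-(n * (2 * Real.pi * Complex.I)) / m) * (Real.exp (-Real.log (s t) / m) : ℝ) :=
    fun t m => by
      rw [hLt, Complex.ofReal_exp, ← Complex.exp_add]
      congr 1
      push_cast
      ring
  have hroot : ∀ (t : I) (m : ℕ), m ≠ 0 → Real.exp (-Real.log (s t) / m) ^ m = (s t)⁻¹ :=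
    fun t m hm => by
      rw [← Real.exp_nat_mul, mul_div_cancel₀ _ (Nat.cast_ne_zero.2 hm), Real.exp_neg,
        Real.exp_log (hs0 t)]
  -- the two principal roots
  have hr1 : ∀ t, ((s t : ℂ)⁻¹) ^ (Q : ℂ)⁻¹ = (Real.exp (-Real.log (s t) / Q) : ℝ) := fun t => by
    rw [← ofReal_pow_cpow_inv (Real.exp_nonneg _) hQ, ← Complex.ofReal_pow, hroot t Q hQ,
      Complex.ofReal_inv]
  have hr2 : ∀ t : I, (1 - (s t : ℂ)⁻¹) ^ (P : ℂ)⁻¹ =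
      ((2 * t * Real.exp (-Real.log (s t) / P) : ℝ) : ℂ) := fun t => by
    have := ht0 t
    refine Eq.trans ?_ (ofReal_pow_cpow_inv
      (x := 2 * t * Real.exp (-Real.log (s t) / P)) (by positivity) hP)
    rw [← Complex.ofReal_pow, mul_pow _ _ P, hroot t P hP]
    congr 1
    rw [show (2 * (t : ℝ)) ^ P = s t - 1 by simp [hs], sub_mul, mul_inv_cancel₀ (hs0 t).ne']
    push_cast
    ring
  -- On level `n` the fibre coordinates are the principal roots (the second after division by ε)
  -- times exp(-2πin/Q) and exp(-2πin/P). For t > 0 both factors are 1 exactly when `P * Q ∣ n`.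
  have hstrip : ∀ t, stripFunction P Q ε (u (γ t) * Complex.exp (-L t / Q),
      v (γ t) * Complex.exp (-L t / P)) = Complex.exp (if ((P * Q : ℕ) : ℤ) ∣ n then
        2 * Real.pi * Complex.I * ramp (s t)⁻¹ else 0) := fun t => by
    have hpow : (u (γ t) * Complex.exp (-L t / Q)) ^ Q = (s t : ℂ)⁻¹ := by
      rw [fiber_coord_pow hQ, hu, hexp, one_pow, one_mul]
    have hre : ((s t : ℂ)⁻¹).re = (s t)⁻¹ := by rw [← Complex.ofReal_inv, Complex.ofReal_re]
    have hv' : v (γ t) * Complex.exp (-L t / P) / ε =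
        Complex.exp (-(n * (2 * Real.pi * Complex.I)) / P) *
          ((2 * t * Real.exp (-Real.log (s t) / P) : ℝ) : ℂ) := by
      rw [hv, hsplit]
      push_cast
      field_simp
    unfold stripFunction
    simp only [hpow, hre, hr1, hr2, hv']
    simp only [hu, one_mul, hsplit t Q]
    by_cases hn : ((P * Q : ℕ) : ℤ) ∣ n
    · have hnP : (P : ℤ) ∣ n := (Dvd.intro _ (by push_cast; rfl)).trans hn
      have hnQ : (Q : ℤ) ∣ n := (Dvd.intro_left _ (by push_cast; rfl)).trans hn
      rw [(exp_neg_two_pi_mul_div_eq_one_iff hP).2 hnP, (exp_neg_two_pi_mul_div_eq_one_iff hQ).2 hnQ,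
        one_mul, one_mul, if_pos ⟨rfl, rfl⟩, if_pos hn]
    · rw [if_neg hn, Complex.exp_zero]
      -- At t = 0 the second coordinate vanishes and no longer sees whether `P ∣ n`; there the strip
      -- function is 1 in any case.
      rcases (ht0 t).eq_or_lt with h0 | hpos
      · have : s t = 1 := by simp [hs, ← h0, zero_pow hP]
        rw [this, inv_one, ramp_of_ge (by norm_num)]
        split_ifs
        · simp [Complex.exp_two_pi_mul_I]
        · rfl
      · rw [if_neg]
        rintro ⟨h1, h2⟩
        have e1 := (exp_neg_two_pi_mul_div_eq_one_iff hQ).1 ((mul_eq_right₀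
          (Complex.ofReal_ne_zero.2 (Real.exp_pos _).ne')).1 h1)
        have e2 := (exp_neg_two_pi_mul_div_eq_one_iff hP).1 ((mul_eq_right₀
          (Complex.ofReal_ne_zero.2 (by positivity))).1 h2)
        refine hn ?_
        push_cast
        exact IsCoprime.mul_dvd (Nat.isCoprime_iff_coprime.2 hco) e2 e1
  by_cases hn : ((P * Q : ℕ) : ℤ) ∣ n
  · simp only [if_pos hn] at hstrip ⊢
    have hrc : Continuous fun t => (s t)⁻¹ := hsc.inv₀ fun t => (hs0 t).ne'
    -- Along the path a^Q = 1 / s falls from 1 to 1 / (1 + 2^P) ≤ 1/5, crossing the whole strip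
    -- downwards.
    let θ : Path (2 * Real.pi * Complex.I) (0 : ℂ) :=
      ⟨⟨fun t => 2 * Real.pi * Complex.I * ramp (s t)⁻¹, by fun_prop⟩,
        by
          simp only [hs, Set.Icc.coe_zero, mul_zero, zero_pow hP, add_zero, inv_one]
          rw [ramp_of_ge (by norm_num)]
          simp,
        by
          have h4 : (4 : ℝ) ≤ 2 ^ P := by
            calc (4 : ℝ) = 2 ^ 2 := by norm_num
              _ ≤ 2 ^ P := pow_le_pow_right₀ (by norm_num) hP2
          simp only [hsC]
          rw [ramp_of_le]
          · simp
          · rw [one_div]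
            exact inv_anti₀ (by norm_num) (by linarith)⟩
    refine ⟨_, _, L, θ, fun t => (hexp t).trans (hbr t).symm, fun t => (hstrip t).symm, by ring⟩
  · simp only [if_neg hn] at hstrip ⊢
    refine ⟨_, _, L, Path.refl 0, fun t => (hexp t).trans (hbr t).symm, fun t => (hstrip t).symm,
      by ring⟩

/-- Monodromy along a loop on which `u = 1` and `v` winds once at distance `2` from `0`. -/
theorem liftsTo_meridian {y : X} (γ : Path y y)
    (hu : ∀ t, u (γ t) = 1)
    (hv : ∀ t : I, v (γ t) = 2 * ε * Complex.exp (2 * Real.pi * Complex.I * (t : ℝ)))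
    (hP2 : 2 ≤ P) (n : ℤ) :
    LiftsTo (brieskorn P Q u v) (stripMap hP hQ hε u v) γ
      (n * (2 * Real.pi * Complex.I) + Complex.log (1 + 2 ^ P))
      ((n + P : ℤ) * (2 * Real.pi * Complex.I) + Complex.log (1 + 2 ^ P)) 0 := by
  set E : I → ℂ := fun t => Complex.exp (2 * Real.pi * Complex.I * (P * (t : ℝ))) with hE
  have hE1 : ∀ t, ‖E t‖ = 1 := fun t => by
    rw [hE]
    simp only
    rw [show 2 * Real.pi * Complex.I * (P * ((t : ℝ) : ℂ)) = ((2 * Real.pi * (P * t) : ℝ) : ℂ) *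
      Complex.I by push_cast; ring, Complex.norm_exp_ofReal_mul_I]
  have hE0 : ∀ t, E t ≠ 0 := fun t => Complex.exp_ne_zero _
  have h4 : (4 : ℝ) ≤ 2 ^ P := by
    calc (4 : ℝ) = 2 ^ 2 := by norm_num
      _ ≤ 2 ^ P := pow_le_pow_right₀ (by norm_num) hP2
  -- The factorization 1 + 2^P E = E (E⁻¹ + 2^P) isolates the winding in E; the other factor has
  -- positive real part and a principal logarithm.
  have hslit : ∀ t, (E t)⁻¹ + 2 ^ P ∈ Complex.slitPlane := fun t => by
    left
    have h1 : |((E t)⁻¹).re| ≤ 1 := by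
      refine (Complex.abs_re_le_norm _).trans ?_
      rw [norm_inv, hE1, inv_one]
    have h2 : ((2 : ℂ) ^ P).re = 2 ^ P := by
      rw [← Complex.ofReal_ofNat, ← Complex.ofReal_pow, Complex.ofReal_re]
    rw [Complex.add_re, h2]
    linarith [(abs_le.1 h1).1]
  have hEc : Continuous E := by fun_prop
  have hlog : Continuous fun t => Complex.log ((E t)⁻¹ + 2 ^ P) :=
    ((hEc.inv₀ hE0).add continuous_const).clog hslit
  have hEe0 : E 0 = 1 := by simp [hE]
  have hEe1 : E 1 = 1 := by
    simp only [hE, Set.Icc.coe_one, Complex.ofReal_one, mul_one]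
    rw [mul_comm]
    exact Complex.exp_nat_mul_two_pi_mul_I P
  let L : Path (n * (2 * Real.pi * Complex.I) + Complex.log (1 + 2 ^ P))
      ((n + P : ℤ) * (2 * Real.pi * Complex.I) + Complex.log (1 + 2 ^ P)) :=
    ⟨⟨fun t => n * (2 * Real.pi * Complex.I) + 2 * Real.pi * Complex.I * (P * (t : ℝ)) +
      Complex.log ((E t)⁻¹ + 2 ^ P), by fun_prop⟩, by simp [hEe0], by
        simp only [hEe1, Set.Icc.coe_one]
        push_cast
        rw [inv_one]
        ring⟩
  have hbr : ∀ t, brieskorn P Q u v (γ t) = 1 + 2 ^ P * E t := fun t => by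
    rw [brieskorn_apply, hu, hv, mul_pow, mul_pow, hε, one_pow, ← Complex.exp_nat_mul]
    simp only [hE]
    rw [show (P : ℂ) * (2 * Real.pi * Complex.I * ((t : ℝ) : ℂ)) =
      2 * Real.pi * Complex.I * (P * ((t : ℝ) : ℂ)) by ring]
    ring
  have hexp : ∀ t, Complex.exp (L t) = 1 + 2 ^ P * E t := fun t => by
    change Complex.exp (n * (2 * Real.pi * Complex.I) + 2 * Real.pi * Complex.I * (P * (t : ℝ)) +
      Complex.log ((E t)⁻¹ + 2 ^ P)) = _
    rw [Complex.exp_add, Complex.exp_add, Complex.exp_int_mul_two_pi_mul_I, one_mul,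
      Complex.exp_log (Complex.slitPlane_ne_zero (hslit t)), mul_add]
    change E t * (E t)⁻¹ + E t * _ = _
    rw [mul_inv_cancel₀ (hE0 t)]
    ring
  refine ⟨0, 0, L, Path.refl 0, fun t => (hexp t).trans (hbr t).symm, fun t => ?_, by simp⟩
  -- Here a^Q = 1 / (1 + 2^P E) has norm at most 1 / (2^P - 1) ≤ 1/3, before the strip.
  refine (Complex.exp_zero.trans (stripFunction_of_le ?_).symm)
  simp only
  rw [fiber_coord_pow hQ, hu, one_pow, one_mul, hexp]
  refine (Complex.re_le_norm _).trans ?_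
  rw [norm_inv, one_div]
  refine inv_anti₀ (by norm_num) ?_
  have h1 : ‖(2 : ℂ) ^ P * E t‖ = 2 ^ P := by rw [norm_mul, norm_pow, hE1]; simp
  have h2 := norm_sub_le (1 + 2 ^ P * E t) 1
  rw [add_sub_cancel_left, h1, norm_one] at h2
  linarith

end Monodromy

/-! ### Homotopies from squares and periodic curves -/

section Squares

open unitInterval

variable {X : Type*} [TopologicalSpace X]

/-- The two boundary paths of a square are homotopic. -/
theorem homotopic_of_square (G : C(I × I, X)) {x y w z : X} {a : Path x y} {b : Path y z}
    {c : Path x w} {d : Path w z} (ha : ∀ t, G (0, t) = a t) (hb : ∀ t, G (t, 1) = b t)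
    (hc : ∀ t, G (t, 0) = c t) (hd : ∀ t, G (1, t) = d t) :
    (a.trans b).Homotopic (c.trans d) := by
  let α : Path ((0, 0) : I × I) (0, 1) := ⟨⟨fun t => (0, t), by fun_prop⟩, rfl, rfl⟩
  let β : Path ((0, 1) : I × I) (1, 1) := ⟨⟨fun t => (t, 1), by fun_prop⟩, rfl, rfl⟩
  let γ : Path ((0, 0) : I × I) (1, 0) := ⟨⟨fun t => (t, 0), by fun_prop⟩, rfl, rfl⟩
  let δ : Path ((1, 0) : I × I) (1, 1) := ⟨⟨fun t => (1, t), by fun_prop⟩, rfl, rfl⟩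
  have h := ((SimplyConnectedSpace.paths_homotopic (α.trans β) (γ.trans δ)).map G).pathCast
    (x₂ := x) (x₃ := z) (by rw [ha, a.source]) (by rw [hb, b.target])
  have e1 : ((α.trans β).map G.continuous).cast (by rw [ha, a.source] : x = G (0, 0))
      (by rw [hb, b.target] : z = G (1, 1)) = a.trans b := by
    ext t
    rw [Path.cast_coe, Path.map_coe, Function.comp_apply, Path.trans_apply, Path.trans_apply]
    split_ifs
    exacts [ha _, hb _]
  have e2 : ((γ.trans δ).map G.continuous).cast (by rw [ha, a.source] : x = G (0, 0))
      (by rw [hb, b.target] : z = G (1, 1)) = c.trans d := by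
    ext t
    rw [Path.cast_coe, Path.map_coe, Function.comp_apply, Path.trans_apply, Path.trans_apply]
    split_ifs
    exacts [hc _, hd _]
  exact e1 ▸ e2 ▸ h

/-- A periodic curve run `n` times. -/
def periodicLoop (g : C(ℝ, X)) (hg : Function.Periodic g 1) (n : ℕ) : Path (g 0) (g 0) where
  toFun t := g (n * t)
  continuous_toFun := by fun_prop
  source' := by simp
  target' := by simpa using hg.nat_mul_eq n

theorem periodicLoop_apply (g : C(ℝ, X)) (hg : Function.Periodic g 1) (n : ℕ) (t : I) :
    periodicLoop g hg n t = g (n * t) := rfl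

theorem periodicLoop_succ_homotopic (g : C(ℝ, X)) (hg : Function.Periodic g 1) (n : ℕ) :
    (periodicLoop g hg (n + 1)).Homotopic ((periodicLoop g hg n).trans (periodicLoop g hg 1)) := by
  let α : Path (0 : ℝ) (n + 1) := ⟨⟨fun t => (n + 1) * t, by fun_prop⟩, by simp, by simp⟩
  let β : Path (0 : ℝ) n := ⟨⟨fun t => n * t, by fun_prop⟩, by simp, by simp⟩
  let γ : Path (n : ℝ) (n + 1) := ⟨⟨fun t => n + t, by fun_prop⟩, by simp, by simp⟩
  have hn : g 0 = g (n + 1) := by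
    have := hg.nat_mul_eq (n + 1)
    push_cast at this
    rw [← this, mul_one]
  have h := ((SimplyConnectedSpace.paths_homotopic α (β.trans γ)).map g).pathCast
    (x₂ := g 0) (x₃ := g 0) rfl hn
  have e1 : (α.map g.continuous).cast rfl hn = periodicLoop g hg (n + 1) := by
    ext t
    rw [periodicLoop_apply]
    push_cast
    rfl
  have e2 : ((β.trans γ).map g.continuous).cast rfl hn =
      (periodicLoop g hg n).trans (periodicLoop g hg 1) := by
    ext t
    rw [Path.cast_coe, Path.map_coe, Function.comp_apply, Path.trans_apply, Path.trans_apply]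
    split_ifs with ht
    · rfl
    · rw [periodicLoop_apply]
      change g (n + _) = g ((1 : ℕ) * _)
      rw [Nat.cast_one, one_mul, add_comm]
      simpa using hg.nat_mul n _
  exact e1 ▸ e2 ▸ h

theorem fromPath_periodicLoop (g : C(ℝ, X)) (hg : Function.Periodic g 1) (n : ℕ) :
    FundamentalGroup.fromPath (Path.Homotopic.Quotient.mk (periodicLoop g hg n)) =
      FundamentalGroup.fromPath (Path.Homotopic.Quotient.mk (periodicLoop g hg 1)) ^ n := by
  induction n with
  | zero =>
    rw [pow_zero, FundamentalGroup.one_def, ← Path.Homotopic.Quotient.mk_refl]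
    refine congrArg Path.Homotopic.Quotient.mk (Path.ext (funext fun t => ?_))
    rw [periodicLoop_apply]
    simp
  | succ n ih =>
    rw [pow_succ', ← ih, FundamentalGroup.mul_def]
    exact (Path.Homotopic.Quotient.eq.2 (periodicLoop_succ_homotopic g hg n)).trans
      (Path.Homotopic.Quotient.mk_trans _ _)

end Squares

/-! ### The commutation relation in the solid torus -/

section SolidTorus

open unitInterval

/-- The complement of the curve `z ^ Q = w ^ P` in `S¹ × ℂ`. -/
abbrev CurveComplement (P Q : ℕ) : Type := {q : Circle × ℂ // (q.1 : ℂ) ^ Q ≠ q.2 ^ P}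

namespace CurveComplement

variable {P Q : ℕ} {ε : ℂ}

/-- The factor ε makes w^P a nonpositive multiple of the Q-th power of the first coordinate, so the
cylinder from the core to the outer torus misses the curve. -/
theorem ne_of_ray (hε : ε ^ P = -1) (z : Circle) {s : ℝ} (hs : 0 ≤ s) :
    ((z ^ P : Circle) : ℂ) ^ Q ≠ (s * ε * (z : ℂ) ^ Q) ^ P := by
  intro h
  rw [Circle.coe_pow, mul_pow, mul_pow, hε, ← pow_mul, ← pow_mul, mul_comm Q P] at h
  have h1 : ((1 + s ^ P : ℝ) : ℂ) * (z : ℂ) ^ (P * Q) = 0 := by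
    push_cast
    linear_combination h
  rcases mul_eq_zero.1 h1 with h2 | h2
  · rw [Complex.ofReal_eq_zero] at h2
    have : 0 ≤ s ^ P := by positivity
    linarith
  · exact pow_ne_zero _ z.coe_ne_zero h2

theorem norm_eq_one_of_pow (hP : P ≠ 0) (hε : ε ^ P = -1) : ‖ε‖ = 1 := by
  have : ‖ε‖ ^ P = 1 := by rw [← norm_pow, hε, norm_neg, norm_one]
  exact (pow_eq_one_iff_of_nonneg (norm_nonneg _) hP).1 this

theorem ne_of_norm (hP : P ≠ 0) (z : Circle) {w : ℂ} (hw : 1 < ‖w‖) :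
    (z : ℂ) ^ Q ≠ w ^ P := by
  intro h
  have h1 := congrArg norm h
  rw [norm_pow, norm_pow, Circle.norm_coe, one_pow] at h1
  linarith [one_lt_pow₀ hw hP]

variable (hP : P ≠ 0) (hε : ε ^ P = -1)

/-- The cylinder of multiples of the curve `(z ^ P, ε * z ^ Q)`. -/
noncomputable def cylinder (hε : ε ^ P = -1) : C(I × ℝ, CurveComplement P Q) where
  toFun q := ⟨(Circle.exp (2 * Real.pi * q.2) ^ P,
    (2 * q.1 : ℝ) * ε * (Circle.exp (2 * Real.pi * q.2) : ℂ) ^ Q),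
    ne_of_ray hε _ (mul_nonneg zero_le_two q.1.2.1)⟩
  continuous_toFun := by fun_prop

/-- The torus `‖w‖ = 2`. -/
noncomputable def torus (hP : P ≠ 0) (hε : ε ^ P = -1) : C(ℝ × ℝ, CurveComplement P Q) where
  toFun q := ⟨(Circle.exp (2 * Real.pi * q.2) ^ P,
    2 * ε * (Circle.exp (2 * Real.pi * q.2) : ℂ) ^ Q * (Circle.exp (2 * Real.pi * q.1) : ℂ)),
    ne_of_norm hP _ (by simp [norm_eq_one_of_pow hP hε, Circle.norm_coe, -Circle.coe_exp])⟩
  continuous_toFun := by fun_prop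

/-- The core curve. -/
noncomputable def coreCurve (hP : P ≠ 0) : C(ℝ, CurveComplement P Q) where
  toFun t := ⟨(Circle.exp (2 * Real.pi * t), 0), by simp [hP]⟩
  continuous_toFun := by fun_prop

theorem circle_exp_two_pi_add_one (t : ℝ) :
    Circle.exp (2 * Real.pi * (t + 1)) = Circle.exp (2 * Real.pi * t) := by
  rw [mul_add, mul_one, Circle.exp_add, Circle.exp_two_pi, mul_one]

theorem periodic_coreCurve : Function.Periodic (coreCurve (Q := Q) hP) 1 := fun t =>
  Subtype.ext (Prod.ext (circle_exp_two_pi_add_one t) rfl)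

theorem periodic_torus_left : Function.Periodic
    (⟨fun t => torus hP hε (t, 0), by fun_prop⟩ : C(ℝ, CurveComplement P Q)) 1 := fun t =>
  Subtype.ext (Prod.ext rfl (by simp [torus, circle_exp_two_pi_add_one, -Circle.coe_exp]))

theorem periodic_torus_right : Function.Periodic
    (⟨fun t => torus hP hε (0, t), by fun_prop⟩ : C(ℝ, CurveComplement P Q)) 1 := fun t => by
  refine Subtype.ext (Prod.ext ?_ ?_) <;> simp [torus, circle_exp_two_pi_add_one, -Circle.coe_exp]

/-- The loop around the core. -/
noncomputable def core (n : ℕ) :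
    Path (coreCurve (Q := Q) hP 0) (coreCurve hP 0) := periodicLoop _ (periodic_coreCurve hP) n

/-- The meridian on the torus `‖w‖ = 2`. -/
noncomputable def meridian : Path (torus (Q := Q) hP hε (0, 0)) (torus hP hε (0, 0)) :=
  periodicLoop _ (periodic_torus_left hP hε) 1

/-- The loop on the torus `‖w‖ = 2` that is parallel to the curve. -/
noncomputable def parallel : Path (torus (Q := Q) hP hε (0, 0)) (torus hP hε (0, 0)) :=
  periodicLoop _ (periodic_torus_right hP hε) 1

/-- The arc from the core to the torus. -/
noncomputable def arc : Path (coreCurve (Q := Q) hP 0) (torus hP hε (0, 0)) where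
  toFun t := cylinder hε (t, 0)
  continuous_toFun := by fun_prop
  source' := Subtype.ext (Prod.ext (by simp [cylinder, coreCurve]) (by simp [cylinder, coreCurve]))
  target' := Subtype.ext (Prod.ext (by simp [cylinder, torus]) (by simp [cylinder, torus]))

variable {hP hε}

theorem core_fst (n : ℕ) (t : I) :
    (core (Q := Q) hP n t).1.1 = Circle.exp (2 * Real.pi * (n * t)) := rfl

theorem core_snd (n : ℕ) (t : I) : (core (Q := Q) hP n t).1.2 = 0 := rfl

theorem meridian_fst (t : I) : (meridian (Q := Q) hP hε t).1.1 = 1 := by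
  change Circle.exp (2 * Real.pi * 0) ^ P = 1
  simp

theorem meridian_snd (t : I) :
    (meridian (Q := Q) hP hε t).1.2 = 2 * ε * (Circle.exp (2 * Real.pi * t) : ℂ) := by
  change 2 * ε * (Circle.exp (2 * Real.pi * 0) : ℂ) ^ Q *
    (Circle.exp (2 * Real.pi * ((1 : ℕ) * t)) : ℂ) = _
  simp

theorem parallel_fst (t : I) :
    (parallel (Q := Q) hP hε t).1.1 = Circle.exp (2 * Real.pi * t) ^ P := by
  change Circle.exp (2 * Real.pi * ((1 : ℕ) * t)) ^ P = _
  simp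

theorem parallel_snd (t : I) : (parallel (Q := Q) hP hε t).1.2 =
    2 * ε * (Circle.exp (2 * Real.pi * t) : ℂ) ^ Q := by
  change 2 * ε * (Circle.exp (2 * Real.pi * ((1 : ℕ) * t)) : ℂ) ^ Q *
    (Circle.exp (2 * Real.pi * 0) : ℂ) = _
  simp

theorem arc_fst (t : I) : (arc (Q := Q) hP hε t).1.1 = 1 := by
  change Circle.exp (2 * Real.pi * 0) ^ P = 1
  simp

theorem arc_snd (t : I) : (arc (Q := Q) hP hε t).1.2 = (2 * t : ℝ) * ε := by
  change ((2 * t : ℝ) : ℂ) * ε * (Circle.exp (2 * Real.pi * 0) : ℂ) ^ Q = _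
  simp

variable (hP hε)

/-- The cylinder (z^P, s ε z^Q) is the core run P times at s = 0 and the parallel curve at s = 2;
cut open along the arc, it is the required square. -/
theorem core_trans_arc_homotopic : ((core (Q := Q) hP P).trans (arc hP hε)).Homotopic
    ((arc hP hε).trans (parallel hP hε)) := by
  refine homotopic_of_square ⟨fun q => cylinder hε (q.1, q.2), by fun_prop⟩ (fun t => ?_)
    (fun t => ?_) (fun t => rfl) fun t => ?_
  · refine Subtype.ext (Prod.ext ?_ (by simp [cylinder, core_snd]))
    rw [core_fst]
    simp only [cylinder, ContinuousMap.coe_mk]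
    rw [← Circle.exp_nsmul, nsmul_eq_mul]
    congr 1
    ring
  · refine Subtype.ext (Prod.ext ?_ ?_)
    · rw [arc_fst]; simp [cylinder]
    · rw [arc_snd]; simp [cylinder]
  · refine Subtype.ext (Prod.ext ?_ ?_)
    · rw [parallel_fst]; simp [cylinder]
    · rw [parallel_snd]; simp [cylinder]

theorem parallel_trans_meridian_homotopic :
    ((parallel (Q := Q) hP hε).trans (meridian hP hε)).Homotopic
      ((meridian hP hε).trans (parallel hP hε)) := by
  refine homotopic_of_square ⟨fun q => torus hP hε (q.1, q.2), by fun_prop⟩ (fun t => ?_)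
    (fun t => ?_) (fun t => ?_) fun t => ?_
  all_goals refine Subtype.ext (Prod.ext ?_ ?_)
  all_goals first
    | rw [parallel_fst] | rw [parallel_snd] | rw [meridian_fst] | rw [meridian_snd]
  all_goals simp [torus]

/-- Conjugation by the arc carries the P-th power of the core to the parallel curve, which commutes
with the meridian because both lie on one torus. -/
theorem commute_core_meridian :
    Commute (FundamentalGroup.fromPath (Path.Homotopic.Quotient.mk (core (Q := Q) hP 1)) ^ P)
      (FundamentalGroup.fromPath (Path.Homotopic.Quotient.mk
        ((arc hP hε).trans ((meridian hP hε).trans (arc hP hε).symm)))) := by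
  have hpow : FundamentalGroup.fromPath (Path.Homotopic.Quotient.mk (core (Q := Q) hP P)) =
      FundamentalGroup.fromPath (Path.Homotopic.Quotient.mk (core (Q := Q) hP 1)) ^ P :=
    fromPath_periodicLoop _ (periodic_coreCurve (Q := Q) hP) P
  rw [← hpow]
  have h1 := Path.Homotopic.Quotient.eq.2 (core_trans_arc_homotopic (Q := Q) hP hε)
  have h2 := Path.Homotopic.Quotient.eq.2 (parallel_trans_meridian_homotopic (Q := Q) hP hε)
  rw [commute_iff_eq, FundamentalGroup.mul_def, FundamentalGroup.mul_def]
  rw [Path.Homotopic.Quotient.mk_trans, Path.Homotopic.Quotient.mk_trans] at h1 h2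
  rw [Path.Homotopic.Quotient.mk_trans, Path.Homotopic.Quotient.mk_trans,
    Path.Homotopic.Quotient.mk_symm]
  generalize Path.Homotopic.Quotient.mk (core (Q := Q) hP P) = c at h1 ⊢
  generalize Path.Homotopic.Quotient.mk (arc (Q := Q) hP hε) = a at h1 ⊢
  generalize Path.Homotopic.Quotient.mk (meridian (Q := Q) hP hε) = m at h2 ⊢
  generalize Path.Homotopic.Quotient.mk (parallel (Q := Q) hP hε) = l at h1 h2
  have h3 : a.symm.trans c = l.trans a.symm := by
    have := congrArg (fun q => (a.symm.trans q).trans a.symm) h1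
    simp only [Path.Homotopic.Quotient.trans_assoc] at this
    simp only [Path.Homotopic.Quotient.trans_symm, Path.Homotopic.Quotient.trans_refl] at this
    rw [this, ← Path.Homotopic.Quotient.trans_assoc, Path.Homotopic.Quotient.symm_trans,
      Path.Homotopic.Quotient.refl_trans]
  simp only [Path.Homotopic.Quotient.trans_assoc]
  rw [h3, ← Path.Homotopic.Quotient.trans_assoc c, h1, ← Path.Homotopic.Quotient.trans_assoc m,
    ← h2]
  simp only [Path.Homotopic.Quotient.trans_assoc]

end CurveComplement

end SolidTorus

/-! ### From maps of spaces to generalized torsion -/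

section Criterion

open unitInterval CurveComplement

variable {X : Type*} [TopologicalSpace X]

/-- A space that receives a map from the complement of the curve `z ^ Q = w ^ P` and maps to the
complement of `u ^ Q = v ^ P` compatibly has a generalized torsion element of order `p` in its
fundamental group. -/
theorem exists_gord_eq_of_maps {p k P Q : ℕ} (hPk : P = p * k) (hp : 1 < p) (hk : 0 < k) (hpQ : p < Q)
    (hco : Nat.Coprime P Q) (j : C(CurveComplement P Q, X)) (u v : C(X, ℂ))
    (huv : ∀ x, u x ^ Q ≠ v x ^ P)
    (hju : ∀ q, ‖q.1.2‖ ≤ 2 → u (j q) = q.1.1) (hjv : ∀ q, ‖q.1.2‖ ≤ 2 → v (j q) = q.1.2) :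
    ∃ x₀ : X, ∃ g : FundamentalGroup X x₀, IsGenTorsion g ∧ gord g = (p : ℕ∞) ∧
      g ∉ ⁅commutator (FundamentalGroup X x₀), commutator (FundamentalGroup X x₀)⁆ := by
  have hP : P ≠ 0 := by rw [hPk]; positivity
  have hQ : Q ≠ 0 := by omega
  have hP2 : 2 ≤ P := hPk ▸ hp.trans_le (Nat.le_mul_of_pos_right _ hk)
  obtain ⟨ε, hε⟩ := IsAlgClosed.exists_pow_nat_eq (-1 : ℂ) (Nat.pos_of_ne_zero hP)
  have hε1 := norm_eq_one_of_pow hP hε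
  refine ⟨j (coreCurve hP 0), ?_⟩
  set F := brieskorn P Q u v with hF
  set H := stripMap hP hQ hε u v with hH
  have hF0 : ∀ x, F x ≠ 0 := fun x => sub_ne_zero.2 (huv x)
  have hH0 : ∀ q, H q ≠ 0 := fun q => stripFunction_ne_zero _
  have hFx : F (j (coreCurve hP 0)) = 1 := by
    rw [hF, brieskorn_apply, hju _ (by simp [coreCurve]), hjv _ (by simp [coreCurve])]
    simp [coreCurve, hP]
  obtain ⟨c, hc⟩ := exists_degreeCocycle hF0 hH0 _ hFx
  have hcore : ∀ n : ℤ, LiftsTo F H ((core hP 1).map j.continuous) (n * (2 * Real.pi * Complex.I))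
      ((n + Q : ℤ) * (2 * Real.pi * Complex.I)) 0 := by
    refine liftsTo_core hP hQ hε _ (fun t => ?_) (fun t => ?_)
    · rw [Path.map_coe, Function.comp_apply, hju _ (by simp [core_snd]), core_fst,
        Circle.coe_exp]
      congr 1
      push_cast
      ring
    · rw [Path.map_coe, Function.comp_apply, hjv _ (by simp [core_snd]), core_snd]
  have harc : ∀ n : ℤ, LiftsTo F H ((arc hP hε).map j.continuous) (n * (2 * Real.pi * Complex.I))
      (n * (2 * Real.pi * Complex.I) + Complex.log (1 + 2 ^ P))
      (if ((P * Q : ℕ) : ℤ) ∣ n then -(2 * Real.pi * Complex.I) else 0) := by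
    have hnorm : ∀ t : I, ‖(arc (Q := Q) hP hε t).1.2‖ ≤ 2 := fun t => by
      rw [arc_snd, norm_mul, hε1, mul_one, Complex.norm_real, Real.norm_of_nonneg
        (mul_nonneg zero_le_two t.2.1)]
      linarith [t.2.2]
    refine liftsTo_arc hP hQ hε hco _ (fun t => ?_) (fun t => ?_) hP2
    · rw [Path.map_coe, Function.comp_apply, hju _ (hnorm t), arc_fst, Circle.coe_one]
    · rw [Path.map_coe, Function.comp_apply, hjv _ (hnorm t), arc_snd]
      push_cast
      rfl
  have hmer : ∀ n : ℤ, LiftsTo F H ((meridian hP hε).map j.continuous)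
      (n * (2 * Real.pi * Complex.I) + Complex.log (1 + 2 ^ P))
      ((n + P : ℤ) * (2 * Real.pi * Complex.I) + Complex.log (1 + 2 ^ P)) 0 := by
    have hnorm : ∀ t : I, ‖(meridian (Q := Q) hP hε t).1.2‖ ≤ 2 := fun t => by
      rw [meridian_snd]
      simp [hε1, Circle.norm_coe, -Circle.coe_exp]
    refine liftsTo_meridian hP hQ hε _ (fun t => ?_) (fun t => ?_) hP2
    · rw [Path.map_coe, Function.comp_apply, hju _ (hnorm t), meridian_fst, Circle.coe_one]
    · rw [Path.map_coe, Function.comp_apply, hjv _ (hnorm t), meridian_snd, Circle.coe_exp]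
      congr 2
      push_cast
      ring
  subst hPk
  refine c.exists_gord_eq hp hk hpQ hco
    (x := FundamentalGroup.fromPath (Path.Homotopic.Quotient.mk ((core hP 1).map j.continuous)))
    (y := FundamentalGroup.fromPath (Path.Homotopic.Quotient.mk
      (((arc hP hε).trans ((meridian hP hε).trans (arc hP hε).symm)).map j.continuous)))
    ?_ ?_ ?_ ?_ (-(2 * Real.pi * Complex.I)) (neg_ne_zero.2 Complex.two_pi_I_ne_zero)
    (fun n => if ((p * k * Q : ℕ) : ℤ) ∣ n then -(2 * Real.pi * Complex.I) else 0) (fun n => rfl) ?_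
  · have := (commute_core_meridian (Q := Q) hP hε).map (FundamentalGroup.map j _)
    rwa [map_pow] at this
  · rw [(hc _ _ _ _ (hcore 0)).1]; ring
  · exact fun n => (hc _ _ _ _ (hcore n)).2
  all_goals
    -- The meridian raises the level by `p * k`, so the arc is traversed back on level `n + p * k`;
    -- the two arc contributions do not cancel but give the first difference.
    have hy : ∀ n : ℤ, LiftsTo F H (((arc hP hε).trans ((meridian hP hε).trans
        (arc hP hε).symm)).map j.continuous) (n * (2 * Real.pi * Complex.I))
        ((n + (p * k : ℕ) : ℤ) * (2 * Real.pi * Complex.I))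
        ((if ((p * k * Q : ℕ) : ℤ) ∣ n then -(2 * Real.pi * Complex.I) else 0) +
          (0 + -(if ((p * k * Q : ℕ) : ℤ) ∣ n + (p * k : ℕ) then -(2 * Real.pi * Complex.I) else 0))) := by
      intro n
      rw [Path.map_trans, Path.map_trans, ← Path.map_symm]
      exact (harc n).trans ((hmer n).trans (harc (n + (p * k : ℕ))).symm)
  · rw [(hc _ _ _ _ (hy 0)).1]; ring
  · intro n
    rw [(hc _ _ _ _ (hy n)).2]
    ring

end Criterion

/-! ### Extending the solid torus coordinates to the complement -/

section ComplementMap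

namespace TubularNeighborhood

variable {C : Set ThreeSphere} (T : TubularNeighborhood C) {P Q : ℕ}

/-- By coprimality, a solution of z^Q = w^P has the form z = c^P, w = c^Q, and |z| = 1 forces |c| =
1. -/
theorem mem_cable_iff (hP : P ≠ 0) (hco : Nat.Coprime P Q) (z : Circle) (w : ℂ) :
    T.toFun (z, w) ∈ T.cable P Q ↔ (z : ℂ) ^ Q = w ^ P := by
  constructor
  · rintro ⟨ζ, hζ⟩
    have h := T.isOpenEmbedding.injective hζ
    rw [Prod.mk.injEq] at h
    rw [← h.1, ← h.2, Circle.coe_pow, ← pow_mul, ← pow_mul, mul_comm]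
  · intro h
    obtain ⟨c, hc, hc'⟩ := (pow_eq_pow_iff_of_coprime hco).1 h.symm
    have hc1 : ‖c‖ = 1 := by
      have := congrArg norm hc'
      rw [norm_pow, Circle.norm_coe] at this
      exact (pow_eq_one_iff_of_nonneg (norm_nonneg _) hP).1 this.symm
    obtain ⟨ζ, rfl⟩ : ∃ ζ : Circle, (ζ : ℂ) = c := ⟨⟨c, mem_sphere_zero_iff_norm.2 hc1⟩, rfl⟩
    rw [← Circle.coe_pow, Circle.coe_inj] at hc'
    exact ⟨ζ, by rw [hc, hc']⟩

/-- The inclusion of the complement of the cable in the tubular neighbourhood. -/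
noncomputable def cableInclusion (hP : P ≠ 0) (hco : Nat.Coprime P Q) :
    C(CurveComplement P Q, ((T.cable P Q)ᶜ : Set ThreeSphere)) where
  toFun q := ⟨T.toFun q.1, fun h => q.2 ((T.mem_cable_iff hP hco _ _).1 h)⟩
  continuous_toFun := (T.isOpenEmbedding.continuous.comp continuous_subtype_val).subtype_mk _

/-- Functions given on the tubular neighbourhood and on the complement of its compact part
`‖w‖ ≤ r` can be glued. -/
theorem exists_glue (r : ℝ) (f : Circle × ℂ → ℂ) (hf : Continuous f) (g : ThreeSphere → ℂ)
    (hg : ContinuousOn g Cᶜ) (hr : 0 ≤ r) (hfg : ∀ q, r < ‖q.2‖ → f q = g (T.toFun q)) :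
    ∃ u : C(ThreeSphere, ℂ), (∀ q, u (T.toFun q) = f q) ∧
      ∀ x ∉ Set.range T.toFun, u x = g x := by
  classical
  set φ := T.isOpenEmbedding.toOpenPartialHomeomorph T.toFun with hφ
  have hsymm : ∀ q, φ.symm (T.toFun q) = q := fun q => φ.left_inv (by simp [hφ])
  set D : Set ThreeSphere := T.toFun '' (Set.univ ×ˢ Metric.closedBall 0 r) with hD
  have hDc : IsClosed D :=
    ((isCompact_univ.prod (isCompact_closedBall 0 r)).image T.isOpenEmbedding.continuous).isClosed
  have hCD : Dᶜ ⊆ Cᶜ := by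
    rw [Set.compl_subset_compl, ← T.core_eq]
    rintro _ ⟨z, rfl⟩
    exact ⟨(z, 0), ⟨trivial, by simpa using hr⟩, rfl⟩
  set u : ThreeSphere → ℂ := fun x => if x ∈ Set.range T.toFun then f (φ.symm x) else g x with hu
  have hu1 : ∀ q, u (T.toFun q) = f q := fun q => by
    simp only [hu, if_pos (Set.mem_range_self q), hsymm]
  have hu2 : Set.EqOn u g Dᶜ := by
    intro x hx
    by_cases hxT : x ∈ Set.range T.toFun
    · obtain ⟨q, rfl⟩ := hxT
      rw [hu1]
      refine hfg q (lt_of_not_ge fun h => hx ⟨q, ⟨trivial, by simpa using h⟩, rfl⟩)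
    · simp only [hu, if_neg hxT]
  refine ⟨⟨u, continuous_iff_continuousAt.2 fun x => ?_⟩, hu1, fun x hx => by
    simp only [ContinuousMap.coe_mk, hu, if_neg hx]⟩
  by_cases hxT : x ∈ Set.range T.toFun
  · obtain ⟨q, rfl⟩ := hxT
    rw [T.isOpenEmbedding.continuousAt_iff.symm]
    refine ContinuousAt.congr hf.continuousAt (Filter.Eventually.of_forall fun q => (hu1 q).symm)
  · have hxD : x ∈ Dᶜ := fun ⟨q, _, hq⟩ => hxT ⟨q, hq⟩
    exact ((hg.mono hCD).congr hu2).continuousAt (hDc.isOpen_compl.mem_nhds hxD)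

/-- The complement of a cable maps to the complement of `u ^ Q = v ^ P` in `ℂ²`. -/
theorem IsPreferred.exists_complement_map {T : TubularNeighborhood C} (hT : T.IsPreferred)
    (hP : P ≠ 0) (hQ : Q ≠ 0) (hco : Nat.Coprime P Q) :
    ∃ u v : C(((T.cable P Q)ᶜ : Set ThreeSphere), ℂ), (∀ x, u x ^ Q ≠ v x ^ P) ∧
      (∀ q, ‖q.1.2‖ ≤ 2 → u (T.cableInclusion hP hco q) = q.1.1) ∧
      ∀ q, ‖q.1.2‖ ≤ 2 → v (T.cableInclusion hP hco q) = q.1.2 := by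
  obtain ⟨e, η, he, he0, heη⟩ := hT.exists_linking_function
  set χ : ℝ → ℝ → ℝ := fun a r => max 0 (min 1 (a - r)) with hχ
  have hχ1 : ∀ a r, r ≤ a - 1 → χ a r = 1 := fun a r h => by
    simp only [hχ]
    rw [min_eq_left (by linarith), max_eq_right zero_le_one]
  have hχ0 : ∀ a r, a ≤ r → χ a r = 0 := fun a r h => by
    simp only [hχ]
    rw [max_eq_left ((min_le_right _ _).trans (by linarith))]
  have hχle : ∀ a r, |χ a r| ≤ 1 := fun a r =>
    abs_le.2 ⟨by linarith [le_max_left 0 (min 1 (a - r))], max_le zero_le_one (min_le_left _ _)⟩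
  -- The longitudinal coordinate is damped to 0 for 2 ≤ ‖w‖ ≤ 3. The normal coordinate is changed
  -- into `e` only for 3 ≤ ‖w‖ ≤ 4, by scaling the exponent `η`, which creates no zeros.
  obtain ⟨u, hu, hu'⟩ := T.exists_glue 3 (fun q => χ 3 ‖q.2‖ * q.1) (by fun_prop) 0
    continuousOn_const (by norm_num) fun q hq => by
      simp [hχ0 _ _ hq.le]
  obtain ⟨v, hv, hv'⟩ := T.exists_glue 4
    (fun q => q.2 * Complex.exp ((1 - χ 4 ‖q.2‖ : ℝ) * η q)) (by fun_prop) e he (by norm_num)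
    fun q hq => by
      have : q.2 ≠ 0 := norm_pos_iff.1 (by linarith)
      rw [heη _ _ this]
      simp [hχ0 _ _ hq.le]
  refine ⟨⟨fun x => u x.1, by fun_prop⟩, ⟨fun x => v x.1, by fun_prop⟩, ?_, fun q hq => ?_,
    fun q hq => ?_⟩
  · rintro ⟨x, hx⟩ h
    simp only [ContinuousMap.coe_mk] at h
    by_cases hxT : x ∈ Set.range T.toFun
    · obtain ⟨⟨z, w⟩, rfl⟩ := hxT
      rw [hu, hv] at h
      simp only at h
      -- For ‖w‖ ≤ 2 equality means lying on the cable; for 2 < ‖w‖ ≤ 3 norms exclude it, since |u|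
      -- ≤ 1 < |v|; beyond 3, u = 0 and v ≠ 0.
      rcases le_or_gt ‖w‖ 3 with h3 | h3
      · rw [hχ1 4 ‖w‖ (by linarith)] at h
        simp only [sub_self, Complex.ofReal_zero, zero_mul, Complex.exp_zero, mul_one] at h
        rcases le_or_gt ‖w‖ 2 with h2 | h2
        · rw [hχ1 3 ‖w‖ (by linarith), Complex.ofReal_one, one_mul] at h
          exact hx ((T.mem_cable_iff hP hco z w).2 h)
        · have h1 := congrArg norm h
          rw [norm_pow, norm_pow, norm_mul, Circle.norm_coe, mul_one, Complex.norm_real,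
            Real.norm_eq_abs] at h1
          have := pow_le_one₀ (n := Q) (abs_nonneg _) (hχle 3 ‖w‖)
          linarith [one_lt_pow₀ (by linarith : 1 < ‖w‖) hP]
      · rw [hχ0 3 ‖w‖ h3.le, Complex.ofReal_zero, zero_mul, zero_pow hQ] at h
        have : w ≠ 0 := norm_pos_iff.1 (by linarith)
        exact pow_ne_zero P (mul_ne_zero this (Complex.exp_ne_zero _)) h.symm
    · rw [hu' x hxT, hv' x hxT, Pi.zero_apply, zero_pow hQ] at h
      refine pow_ne_zero P (he0 x fun hxC => hxT ?_) h.symm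
      obtain ⟨z, hz⟩ := T.core_eq.symm.subset hxC
      exact ⟨_, hz⟩
  · change u (T.toFun q.1) = _
    rw [hu, hχ1 _ _ (by linarith), Complex.ofReal_one, one_mul]
  · change v (T.toFun q.1) = _
    rw [hv, hχ1 _ _ (by linarith)]
    simp

end TubularNeighborhood

end ComplementMap

/-! ### Invariance under group isomorphisms -/

section ChangeOfBasePoint

theorem genTorsionSpectrum_subset_map {G H : Type*} [Group G] [Group H] (f : G →* H) (g : G) :
    genTorsionSpectrum g ⊆ genTorsionSpectrum (f g) := by
  rintro n ⟨hn, x, hx⟩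
  refine ⟨hn, fun i => f (x i), ?_⟩
  have := congrArg f hx
  rw [map_one, map_list_prod, List.map_ofFn] at this
  simpa [Function.comp_def] using this

theorem genTorsionSpectrum_mulEquiv {G H : Type*} [Group G] [Group H] (e : G ≃* H) (g : G) :
    genTorsionSpectrum (e g) = genTorsionSpectrum g := by
  refine Set.Subset.antisymm ?_ (genTorsionSpectrum_subset_map e.toMonoidHom g)
  simpa using genTorsionSpectrum_subset_map e.symm.toMonoidHom (e g)

theorem map_commutator_commutator_le {G H : Type*} [Group G] [Group H] (f : G →* H) :
    ⁅commutator G, commutator G⁆.map f ≤ ⁅commutator H, commutator H⁆ := by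
  have h : (commutator G).map f ≤ commutator H := by
    rw [commutator_def, Subgroup.map_commutator]
    exact Subgroup.commutator_mono le_top le_top
  rw [Subgroup.map_commutator]
  exact Subgroup.commutator_mono h h

theorem exists_gord_eq_of_mulEquiv {G H : Type*} [Group G] [Group H] (e : G ≃* H) {n : ℕ∞}
    (h : ∃ g : G, IsGenTorsion g ∧ gord g = n ∧ g ∉ ⁅commutator G, commutator G⁆) :
    ∃ g : H, IsGenTorsion g ∧ gord g = n ∧ g ∉ ⁅commutator H, commutator H⁆ := by
  obtain ⟨g, ⟨hg1, hg⟩, hgn, hgG⟩ := h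
  refine ⟨e g, ⟨?_, ?_⟩, ?_, fun hmem => hgG ?_⟩
  · rwa [Ne, EmbeddingLike.map_eq_one_iff]
  · rwa [genTorsionSpectrum_mulEquiv]
  · rw [← hgn, gord, gord, genTorsionSpectrum_mulEquiv]
  · simpa using map_commutator_commutator_le e.symm.toMonoidHom (Subgroup.mem_map_of_mem _ hmem)

end ChangeOfBasePoint

/-! ### Path connectedness of the complement -/

section Connectedness

open unitInterval

namespace CurveComplement

variable {P Q : ℕ}

theorem joined_zero (z : Circle) (w : ℂ)
    (h : ∀ s : I, (z : ℂ) ^ Q ≠ ((s : ℝ) * w) ^ P) :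
    Joined (⟨(z, w), by simpa using h 1⟩ : CurveComplement P Q)
      ⟨(z, 0), by simpa using h 0⟩ := by
  refine Joined.symm ⟨⟨⟨fun s => ⟨(z, (s : ℝ) * w), h s⟩, by fun_prop⟩, ?_, ?_⟩⟩ <;> simp

theorem joined_of_norm_eq (hP : P ≠ 0) (z : Circle) {w w' : ℂ} (hw : 1 < ‖w‖)
    (hww' : ‖w'‖ = ‖w‖) :
    Joined (⟨(z, w), ne_of_norm hP z hw⟩ : CurveComplement P Q)
      ⟨(z, w'), ne_of_norm hP z (hww' ▸ hw)⟩ := by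
  have h := (isPathConnected_sphere (E := ℂ) (by rw [Complex.rank_real_complex]; norm_num) 0
    (norm_nonneg w)).joinedIn w (by simp) w' (by simpa using hww')
  have h1 := h.joined_subtype.map (f := fun y : Metric.sphere (0 : ℂ) ‖w‖ =>
    (⟨(z, y.1), ne_of_norm hP z (by simpa using hw)⟩ : CurveComplement P Q)) (by fun_prop)
  exact h1

theorem joined_core (hP : P ≠ 0) (z z' : Circle) :
    Joined (⟨(z, 0), by simp [hP]⟩ : CurveComplement P Q) ⟨(z', 0), by simp [hP]⟩ := by
  obtain ⟨t, rfl⟩ : ∃ t, Circle.exp t = z := ⟨_, Circle.exp_arg z⟩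
  obtain ⟨t', rfl⟩ : ∃ t, Circle.exp t = z' := ⟨_, Circle.exp_arg z'⟩
  exact (PathConnectedSpace.joined t t').map
    (f := fun t => (⟨(Circle.exp t, 0), by simp [hP]⟩ : CurveComplement P Q)) (by fun_prop)

/-- If ‖w‖ ≤ 1, shrinking w radially could meet the curve only where the norm is 1, that is at the
starting point. If ‖w‖ > 1, w is first rotated until w^P is a negative multiple of z^Q, and then
shrunk. -/
theorem joined_one (hP : P ≠ 0) (q : CurveComplement P Q) :
    Joined q ⟨(1, 0), by simp [hP]⟩ := by
  obtain ⟨⟨z, w⟩, hq⟩ := q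
  refine Joined.trans ?_ (joined_core hP z 1)
  rcases le_or_gt ‖w‖ 1 with hw | hw
  · refine joined_zero z w fun s h => ?_
    have h1 := congrArg norm h
    rw [norm_pow, norm_pow, Circle.norm_coe, one_pow, norm_mul, Complex.norm_real,
      Real.norm_of_nonneg s.2.1] at h1
    have h2 := (pow_eq_one_iff_of_nonneg (mul_nonneg s.2.1 (norm_nonneg w)) hP).1 h1.symm
    have h3 : (s : ℝ) = 1 := by nlinarith [s.2.1, s.2.2, norm_nonneg w]
    rw [h3] at h
    exact hq (by simpa using h)
  · obtain ⟨y, hy⟩ := IsAlgClosed.exists_pow_nat_eq (-(z : ℂ) ^ Q) (Nat.pos_of_ne_zero hP)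
    have hy1 : ‖y‖ = 1 := by
      have := congrArg norm hy
      rw [norm_pow, norm_neg, norm_pow, Circle.norm_coe, one_pow] at this
      exact (pow_eq_one_iff_of_nonneg (norm_nonneg _) hP).1 this
    refine (joined_of_norm_eq hP z (w' := ‖w‖ * y) hw (by simp [hy1])).trans
      (joined_zero z _ fun s h => ?_)
    have hz : (z : ℂ) ^ Q ≠ 0 := pow_ne_zero _ z.coe_ne_zero
    rw [← mul_assoc, mul_pow, hy, ← Complex.ofReal_mul] at h
    have h1 : ((1 + ((s : ℝ) * ‖w‖) ^ P : ℝ) : ℂ) * (z : ℂ) ^ Q = 0 := by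
      push_cast at h ⊢
      linear_combination h
    rcases mul_eq_zero.1 h1 with h2 | h2
    · rw [Complex.ofReal_eq_zero] at h2
      have : 0 ≤ ((s : ℝ) * ‖w‖) ^ P := pow_nonneg (mul_nonneg s.2.1 (norm_nonneg w)) _
      linarith
    · exact hz h2

end CurveComplement

/-- A path that ends in a closed set `D` can be cut off at a point of a given neighbourhood `U` of
`D`, before it meets `D`, unless it starts in `D`. -/
theorem Path.exists_joinedIn_of_closed {X : Type*} [TopologicalSpace X] {x y : X} (γ : Path x y)
    {D U : Set X} (hD : IsClosed D) (hU : IsOpen U) (hDU : D ⊆ U) (hy : y ∈ D) :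
    x ∈ D ∨ ∃ z ∈ U, JoinedIn Dᶜ x z := by
  -- The first time in `D`; slightly earlier the path is already in `U` but has not met `D`.
  obtain ⟨t, ht, htmin⟩ := (hD.preimage γ.continuous).isCompact.exists_isLeast
    ⟨1, by simpa using hy⟩
  by_cases ht0 : t = 0
  · left
    simpa [ht0] using ht
  right
  have ht0' : 0 < t := unitInterval.pos_iff_ne_zero.2 ht0
  have hn : γ ⁻¹' U ∈ nhds t := (hU.preimage γ.continuous).mem_nhds (hDU ht)
  obtain ⟨l, hl, hlt⟩ := exists_Ioc_subset_of_mem_nhds hn ⟨0, ht0'⟩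
  have : (Set.Ioo l t).Nonempty := Set.nonempty_Ioo.2 hl
  obtain ⟨s, hs⟩ := this
  refine ⟨γ s, hlt ⟨hs.1, hs.2.le⟩, ⟨⟨⟨fun r => γ (r * s), by fun_prop⟩, by simp, by simp⟩,
    fun r hr => ?_⟩⟩
  have h1 : t ≤ r * s := htmin hr
  exact absurd (h1.trans unitInterval.mul_le_right) (not_le.2 hs.2)

/-- A path in S³ towards a point of the cable enters the tube before it meets the cable, and the
rest takes place in the tube. -/
theorem TubularNeighborhood.joined_cableInclusion {C : Set ThreeSphere}
    (T : TubularNeighborhood C) {P Q : ℕ} (hP : P ≠ 0) (hco : Nat.Coprime P Q)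
    (x : ((T.cable P Q)ᶜ : Set ThreeSphere)) :
    Joined x (T.cableInclusion hP hco ⟨(1, 0), by simp [hP]⟩) := by
  have hT : ∀ y : ((T.cable P Q)ᶜ : Set ThreeSphere), y.1 ∈ Set.range T.toFun →
      Joined y (T.cableInclusion hP hco ⟨(1, 0), by simp [hP]⟩) := by
    rintro ⟨_, hy⟩ ⟨⟨z, w⟩, rfl⟩
    exact (CurveComplement.joined_one hP
      ⟨(z, w), fun h => hy ((T.mem_cable_iff hP hco z w).2 h)⟩).map
      (T.cableInclusion hP hco).continuous
  have hD : IsClosed (T.cable P Q) := by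
    refine (isCompact_range (T.isOpenEmbedding.continuous.comp ?_)).isClosed
    fun_prop
  have hS : IsPathConnected (Metric.sphere (0 : EuclideanSpace ℂ (Fin 2)) 1) := by
    refine isPathConnected_sphere ?_ 0 zero_le_one
    have : Module.finrank ℝ (EuclideanSpace ℂ (Fin 2)) = 4 := by
      rw [← Module.finrank_mul_finrank ℝ ℂ]; simp
    rw [← Module.finrank_eq_rank, this]
    norm_num
  have hK : T.toFun (1, 1) ∈ T.cable P Q := ⟨1, by simp⟩
  have hJ := (isPathConnected_iff_pathConnectedSpace.1 hS).joined x.1 (T.toFun (1, 1))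
  rcases hJ.somePath.exists_joinedIn_of_closed hD T.isOpenEmbedding.isOpen_range
    (by rintro _ ⟨ζ, rfl⟩; exact ⟨_, rfl⟩) hK with h | ⟨y, hy, h⟩
  · exact absurd h x.2
  · exact h.joined_subtype.trans (hT _ hy)

theorem TubularNeighborhood.IsPreferred.exists_gord_eq {C : Set ThreeSphere}
    {T : TubularNeighborhood C} (hT : T.IsPreferred) {p k P Q : ℕ} (hPk : P = p * k) (hp : 1 < p)
    (hk : 0 < k) (hpQ : p < Q) (hco : Nat.Coprime P Q)
    (x : ((T.cable P Q)ᶜ : Set ThreeSphere)) :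
    ∃ g : KnotGroup (T.cable P Q) x, IsGenTorsion g ∧ gord g = (p : ℕ∞) ∧
      g ∉ ⁅commutator (KnotGroup (T.cable P Q) x), commutator (KnotGroup (T.cable P Q) x)⁆ := by
  have hP : P ≠ 0 := by
    rw [hPk]
    exact (Nat.mul_pos (by omega) hk).ne'
  obtain ⟨u, v, huv, hu, hv⟩ := hT.exists_complement_map hP (by omega : Q ≠ 0) hco
  obtain ⟨x₀, h⟩ := exists_gord_eq_of_maps hPk hp hk hpQ hco _ u v huv hu hv
  have hx : Joined x₀ x :=
    (T.joined_cableInclusion hP hco x₀).trans (T.joined_cableInclusion hP hco x).symm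
  exact exists_gord_eq_of_mulEquiv (FundamentalGroup.fundamentalGroupMulEquivOfPath hx.somePath) h

end Connectedness

/-! ### Torus knots as cables of the unknot -/

section TorusKnots

/-- A closed curve that extends over the plane is null-homologous. -/
theorem isNullHomologous_of_extends {X : Type*} [TopologicalSpace X] (F : C(ℂ, X)) :
    IsNullHomologous (F.comp ⟨fun z : Circle => (z : ℂ), by fun_prop⟩) := by
  let i : C(Circle, ℂ) := ⟨fun z => z, by fun_prop⟩
  have h : (circleLoop i).Homotopic (Path.refl (i 1)) := SimplyConnectedSpace.paths_homotopic _ _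
  have h1 : (circleLoop (F.comp i)).Homotopic (Path.refl _) := h.map F
  have h2 : FundamentalGroup.fromPath (Path.Homotopic.Quotient.mk (circleLoop (F.comp i))) = 1 :=
    Path.Homotopic.Quotient.eq.2 h1
  change FundamentalGroup.fromPath (Path.Homotopic.Quotient.mk (circleLoop (F.comp i))) ∈ _
  rw [h2]
  exact one_mem _

/-- The parametrization of the open solid torus `x₀ ≠ 0` in the three-sphere. -/
noncomputable def solidTorusMap : C(Circle × ℂ, ThreeSphere) :=
  sphereMap ⟨fun q => (q.1 : ℂ), by fun_prop⟩ ⟨fun q => q.2, by fun_prop⟩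
    fun q => Or.inl q.1.coe_ne_zero

theorem solidTorusMap_coord (q : Circle × ℂ) :
    (solidTorusMap q).1 0 = ((√(1 + ‖q.2‖ ^ 2) : ℝ) : ℂ)⁻¹ * (q.1 : ℂ) ∧
      (solidTorusMap q).1 1 = ((√(1 + ‖q.2‖ ^ 2) : ℝ) : ℂ)⁻¹ * q.2 := by
  have h := sphereMap_coord ⟨fun q : Circle × ℂ => (q.1 : ℂ), by fun_prop⟩
    ⟨fun q => q.2, by fun_prop⟩ (fun q => Or.inl q.1.coe_ne_zero) q
  simp only [ContinuousMap.coe_mk, Circle.norm_coe, one_pow, Complex.ofReal_inv] at h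
  exact h

theorem solidTorusMap_norm (q : Circle × ℂ) :
    ‖(solidTorusMap q).1 0‖ = (√(1 + ‖q.2‖ ^ 2))⁻¹ := by
  rw [(solidTorusMap_coord q).1, norm_mul, Circle.norm_coe, mul_one, ← Complex.ofReal_inv,
    Complex.norm_real, Real.norm_of_nonneg (by positivity)]

/-- The open solid torus `x₀ ≠ 0` in the three-sphere. -/
noncomputable def openSolidTorus : Circle × ℂ ≃ₜ {x : ThreeSphere // x.1 0 ≠ 0} where
  toFun q := ⟨solidTorusMap q, by
    rw [← norm_ne_zero_iff, solidTorusMap_norm]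
    positivity⟩
  invFun x := (⟨x.1.1 0 / ‖x.1.1 0‖, mem_sphere_zero_iff_norm.2 (by
    rw [norm_div, Complex.norm_real, norm_norm, div_self (norm_ne_zero_iff.2 x.2)])⟩,
    x.1.1 1 / ‖x.1.1 0‖)
  left_inv q := by
    have h := solidTorusMap_coord q
    have hs : ((√(1 + ‖q.2‖ ^ 2) : ℝ) : ℂ)⁻¹ ≠ 0 := by
      rw [← Complex.ofReal_inv, Complex.ofReal_ne_zero]
      positivity
    refine Prod.ext (Circle.ext ?_) ?_
    · change (solidTorusMap q).1 0 / (‖(solidTorusMap q).1 0‖ : ℂ) = _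
      rw [solidTorusMap_norm, h.1, Complex.ofReal_inv, mul_div_cancel_left₀ _ hs]
    · change (solidTorusMap q).1 1 / (‖(solidTorusMap q).1 0‖ : ℂ) = _
      rw [solidTorusMap_norm, h.2, Complex.ofReal_inv, mul_div_cancel_left₀ _ hs]
  right_inv x := by
    have hn := norm_pos_iff.2 x.2
    have hn' : (‖x.1.1 0‖ : ℂ) ≠ 0 := Complex.ofReal_ne_zero.2 hn.ne'
    have hsq : √((1 : ℝ) + ‖x.1.1 1 / (‖x.1.1 0‖ : ℂ)‖ ^ 2) = ‖x.1.1 0‖⁻¹ := by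
      rw [norm_div, Complex.norm_real, norm_norm, ← Real.sqrt_sq (inv_nonneg.2 hn.le)]
      congr 1
      have := threeSphere_norm_sq x.1
      field_simp
      linarith
    refine Subtype.ext (threeSphere_ext ?_ ?_)
    · refine (solidTorusMap_coord _).1.trans ?_
      change ((√((1 : ℝ) + ‖x.1.1 1 / (‖x.1.1 0‖ : ℂ)‖ ^ 2) : ℝ) : ℂ)⁻¹ *
        (x.1.1 0 / (‖x.1.1 0‖ : ℂ)) = _
      rw [hsq, Complex.ofReal_inv, inv_inv, mul_div_cancel₀ _ hn']
    · refine (solidTorusMap_coord _).2.trans ?_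
      change ((√((1 : ℝ) + ‖x.1.1 1 / (‖x.1.1 0‖ : ℂ)‖ ^ 2) : ℝ) : ℂ)⁻¹ *
        (x.1.1 1 / (‖x.1.1 0‖ : ℂ)) = _
      rw [hsq, Complex.ofReal_inv, inv_inv, mul_div_cancel₀ _ hn']
  continuous_toFun := by fun_prop
  continuous_invFun := by
    have h0 : Continuous fun x : {x : ThreeSphere // x.1 0 ≠ 0} => (‖x.1.1 0‖ : ℂ) := by fun_prop
    have h1 : ∀ x : {x : ThreeSphere // x.1 0 ≠ 0}, (‖x.1.1 0‖ : ℂ) ≠ 0 := fun x =>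
      Complex.ofReal_ne_zero.2 (norm_ne_zero_iff.2 x.2)
    exact (Continuous.subtype_mk (Continuous.div (by fun_prop) h0 h1) _).prodMk
      (Continuous.div (by fun_prop) h0 h1)

/-- The tubular neighbourhood `x₀ ≠ 0` of the unknot `x₁ = 0`, up to a homeomorphism of the
three-sphere. -/
noncomputable def unknotNeighborhood (h : ThreeSphere ≃ₜ ThreeSphere) :
    TubularNeighborhood (Set.range fun z : Circle => h (solidTorusMap (z, 0))) where
  toFun q := h (solidTorusMap q)
  isOpenEmbedding := h.isOpenEmbedding.comp
    (((isOpen_ne.preimage (continuous_threeSphere_coord 0)).isOpenEmbedding_subtypeVal).comp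
      openSolidTorus.isOpenEmbedding)
  core_eq := rfl

/-- The longitude (z, 1) / √2 extends over ℂ as the direction of (y, 1), which never meets the core
x₁ = 0. -/
theorem isPreferred_unknotNeighborhood (h : ThreeSphere ≃ₜ ThreeSphere) :
    (unknotNeighborhood h).IsPreferred := by
  let s : C(ℂ, ThreeSphere) := sphereMap (.id ℂ) (.const ℂ 1) fun _ => Or.inr one_ne_zero
  have hs : ∀ y, (s y).1 1 ≠ 0 := fun y => by
    rw [(sphereMap_coord _ _ _ _).2]
    refine mul_ne_zero ?_ one_ne_zero
    rw [Complex.ofReal_ne_zero, ContinuousMap.const_apply, norm_one]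
    positivity
  let F : C(ℂ, ((Set.range fun z : Circle => h (solidTorusMap (z, 0)))ᶜ : Set ThreeSphere)) :=
    ⟨fun y => ⟨h (s y), by
      rintro ⟨z, hz⟩
      refine hs y ?_
      rw [← h.injective hz, (solidTorusMap_coord (z, 0)).2, mul_zero]⟩, by fun_prop⟩
  exact isNullHomologous_of_extends F

theorem cable_unknotNeighborhood (h : ThreeSphere ≃ₜ ThreeSphere) (m n : ℕ) :
    (unknotNeighborhood h).cable m n = h '' standardTorusKnot m n := by
  have hz : ∀ z : Circle,
      (solidTorusMap (z ^ m, (z : ℂ) ^ n)).1 0 = (z : ℂ) ^ m / (√2 : ℂ) ∧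
        (solidTorusMap (z ^ m, (z : ℂ) ^ n)).1 1 = (z : ℂ) ^ n / (√2 : ℂ) := fun z => by
    have := solidTorusMap_coord (z ^ m, (z : ℂ) ^ n)
    simp only [norm_pow, Circle.norm_coe, one_pow, one_add_one_eq_two, Circle.coe_pow] at this
    rw [this.1, this.2, div_eq_inv_mul, div_eq_inv_mul]
    exact ⟨rfl, rfl⟩
  ext x
  constructor
  · rintro ⟨z, rfl⟩
    exact ⟨_, ⟨z, hz z⟩, rfl⟩
  · rintro ⟨y, ⟨z, h0, h1⟩, rfl⟩
    exact ⟨z, congrArg h (threeSphere_ext ((hz z).1.trans h0.symm) ((hz z).2.trans h1.symm))⟩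

end TorusKnots

/-! ### The theorem for torus knots and cables -/

theorem mainTheorem10 (p q a b : ℕ) (hp : p.Prime) (hq : q.Prime) (hpq : p < q)
    (ha : 0 < a) (hb : 0 < b) (K : Set ThreeSphere)
    (hK : IsTorusKnot (p ^ a) (q ^ b) K ∨
      ∃ C : Set ThreeSphere, IsKnot C ∧ IsCableOf (p ^ a) (q ^ b) C K)
    (x : (Kᶜ : Set ThreeSphere)) :
    ∃ g : KnotGroup K x,
      IsGenTorsion g ∧ gord g = (p : ℕ∞) ∧
        g ∉ ⁅commutator (KnotGroup K x), commutator (KnotGroup K x)⁆ := by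
  obtain ⟨C, T, hT, rfl⟩ : ∃ (C : Set ThreeSphere) (T : TubularNeighborhood C),
      T.IsPreferred ∧ K = T.cable (p ^ a) (q ^ b) := by
    rcases hK with ⟨h, rfl⟩ | ⟨C, -, T, hT, rfl⟩
    · exact ⟨_, _, isPreferred_unknotNeighborhood h, (cable_unknotNeighborhood h _ _).symm⟩
    · exact ⟨C, T, hT, rfl⟩
  refine hT.exists_gord_eq (k := p ^ (a - 1)) ?_ hp.one_lt (pow_pos hp.pos _)
    (hpq.trans_le (Nat.le_self_pow hb.ne' q))
    (((Nat.coprime_primes hp hq).2 hpq.ne).pow a b) x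
  rw [← pow_succ', Nat.sub_add_cancel ha]
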